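/- Let $d\ge 0$. Let $X_d$ be the real unital associative algebra generated by $e_1,\dots,e_{d+2}$ with the relations $e_j^2=-\boldsymbol 1$ for $j\le d+1$, $e_je_k=-e_ke_j$ for distinct $j,k\le d+1$, $e_{d+2}^2=0$, and $e_{d+2}e_j=e_je_{d+2}$ for $j\le d+1$. Its standard basis consists of the products, in increasing order, of distinct elements of $\{e_1,\dots,e_{d+2}\}$ (the empty product being $\boldsymbol 1$). Let $i:\mathbb R^d\to X_d$ be the linear map that takes the standard basis of $\mathbb R^d$ to $e_1,\dots,e_d$. Let $\alpha$ be the automorphism of $X_d$ with $\alpha(e_j)=-e_j$ for $j\le d+1$ and $\alpha(e_{d+2})=e_{d+2}$, let $t$ be the anti-automorphism of $X_d$ with $t(e_j)=e_j$ for all $j$, and write $\overline x=\alpha(t(x))$ and $N(x)=x\overline x$. Let $Z_d^0\subset X_d$ be the span of the products, in increasing order, of an even number of distinct elements from the list $e_1,\dots,e_d,\ e_{d+1}e_{d+2}$ (where $e_{d+1}e_{d+2}$ counts as one element). These $2^d$ products form a basis of $Z_d^0$, which identifies $Z_d^0$ with $\mathbb R^{2^d}$; the first coordinate $x_1$ is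 the coefficient of $\boldsymbol 1$, and the basis elements that are products of exactly two elements of the list are called 2-terms (there are $\binom{d+1}2$ of them). Let $C\ell_d$ be the span of the products of distinct elements from $e_1,\dots,e_d$, and let $C\ell_d^0=\{x\in C\ell_d:\alpha(x)=x\}$. Define $$\mathrm{Spun}(d)=\{z\in Z_d^0:\ N(z)=\boldsymbol 1\text{ and for every }v\in\mathbb R^d\text{ there is }w\in\mathbb R^d\text{ with } z(e_{d+2}i(v)+e_{d+1})\overline z=e_{d+2}i(w)+e_{d+1}\},$$ and for $x\in\mathrm{Spun}(d)$ and $v\in\mathbb R^d$ let $v^x$ be the point $w$ with $x(e_{d+2}i(v)+e_{d+1})\overline x=e_{d+2}i(w)+e_{d+1}$. Let $\mathrm{Spun}(d)_+$ be the set of elements of $\mathrm{Spun}(d)$ with $x_1>0$, and let $H_0$ be the hyperplane $x_1=0$. For $a,p\in\mathbb R^d$ let $$T_{ap}=\{x\in\mathrm{Spun}(d):a^x=p\},\qquad F_{ap}=\left(\boldsymbol 1+\tfrac12e_{d+1}e_{d+2}i(p)\right)C\ell_d^0\left(\boldsymbol 1-\tfrac12e_{d+1}e_{d+2}i(a)\right)\subseteq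 Z_d^0.$$ For $x\notin H_0$ let $\eta_d(x)\in\mathbb R^{\binom{d+1}2}$ be the vector of the coefficients of the 2-terms in $x/x_1$. **Lemma.** For all $a,p\in\mathbb R^d$, $$\eta_d\left(T_{ap}\cap\mathrm{Spun}(d)_+\right)=\eta_d\left(F_{ap}\setminus H_0\right),$$ and this set is a (nonempty) affine flat of dimension $\binom d2$ in $\mathbb R^{\binom{d+1}2}$. -/

import Mathlib

namespace Spun

/-! ### The algebra `X_d` -/

/-- Defining relations of `X_d` on the generators `e_1, …, e_{d+2}`: the first `d + 1` generators
anticommute and square to `-1`; the last one is central and squares to `0`. -/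
inductive Rel (d : ℕ) : FreeAlgebra ℝ (Fin (d + 2)) → FreeAlgebra ℝ (Fin (d + 2)) → Prop
  | anticomm (j k : Fin (d + 1)) (h : j ≠ k) :
      Rel d (FreeAlgebra.ι ℝ j.castSucc * FreeAlgebra.ι ℝ k.castSucc
        + FreeAlgebra.ι ℝ k.castSucc * FreeAlgebra.ι ℝ j.castSucc) 0
  | sq (j : Fin (d + 1)) :
      Rel d (FreeAlgebra.ι ℝ j.castSucc * FreeAlgebra.ι ℝ j.castSucc + 1) 0
  | sq_last :
      Rel d (FreeAlgebra.ι ℝ (Fin.last (d + 1)) * FreeAlgebra.ι ℝ (Fin.last (d + 1))) 0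
  | central (j : Fin (d + 1)) :
      Rel d (FreeAlgebra.ι ℝ (Fin.last (d + 1)) * FreeAlgebra.ι ℝ j.castSucc
        - FreeAlgebra.ι ℝ j.castSucc * FreeAlgebra.ι ℝ (Fin.last (d + 1))) 0

/-- The algebra `X_d`: the tensor algebra of `ℝ^{d+2}` (the free algebra on its standard basis)
modulo the two-sided ideal generated by the relations. -/
def X (d : ℕ) : Type := RingQuot (Rel d)

noncomputable instance (d : ℕ) : Ring (X d) := inferInstanceAs (Ring (RingQuot (Rel d)))

noncomputable instance (d : ℕ) : Algebra ℝ (X d) :=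
  inferInstanceAs (Algebra ℝ (RingQuot (Rel d)))

/-- The quotient map. -/
noncomputable def mk (d : ℕ) : FreeAlgebra ℝ (Fin (d + 2)) →ₐ[ℝ] X d :=
  RingQuot.mkAlgHom ℝ (Rel d)

theorem mk_rel {d : ℕ} {x y : FreeAlgebra ℝ (Fin (d + 2))} (h : Rel d x y) : mk d x = mk d y :=
  RingQuot.mkAlgHom_rel ℝ h

/-- The generators; index `j : Fin (d + 2)` stands for `e_{j+1}`. -/
noncomputable def e (d : ℕ) (j : Fin (d + 2)) : X d := mk d (FreeAlgebra.ι ℝ j)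

theorem e_anticomm {d : ℕ} (j k : Fin (d + 1)) (h : j ≠ k) :
    e d j.castSucc * e d k.castSucc = -(e d k.castSucc * e d j.castSucc) := by
  have := mk_rel (Rel.anticomm j k h)
  simp only [map_add, map_mul, map_zero] at this
  exact eq_neg_of_add_eq_zero_left this

theorem e_sq {d : ℕ} (j : Fin (d + 1)) : e d j.castSucc * e d j.castSucc = -1 := by
  have := mk_rel (Rel.sq j)
  simp only [map_add, map_mul, map_zero, map_one] at this
  exact eq_neg_of_add_eq_zero_left this

theorem e_last_sq {d : ℕ} : e d (Fin.last (d + 1)) * e d (Fin.last (d + 1)) = 0 := by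
  have := mk_rel (Rel.sq_last (d := d))
  simp only [map_mul, map_zero] at this
  exact this

theorem e_last_comm {d : ℕ} (j : Fin (d + 1)) :
    e d (Fin.last (d + 1)) * e d j.castSucc = e d j.castSucc * e d (Fin.last (d + 1)) := by
  have := mk_rel (Rel.central j)
  simp only [map_sub, map_mul, map_zero] at this
  exact sub_eq_zero.mp this

/-- Universal property of `X_d`: an algebra map is determined by images of the generators that
satisfy the relations. -/
noncomputable def lift {d : ℕ} {A : Type} [Ring A] [Algebra ℝ A] (f : Fin (d + 2) → A)
    (h1 : ∀ j k : Fin (d + 1), j ≠ k →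
      f j.castSucc * f k.castSucc + f k.castSucc * f j.castSucc = 0)
    (h2 : ∀ j : Fin (d + 1), f j.castSucc * f j.castSucc + 1 = 0)
    (h3 : f (Fin.last (d + 1)) * f (Fin.last (d + 1)) = 0)
    (h4 : ∀ j : Fin (d + 1), f (Fin.last (d + 1)) * f j.castSucc
      - f j.castSucc * f (Fin.last (d + 1)) = 0) : X d →ₐ[ℝ] A :=
  RingQuot.liftAlgHom ℝ ⟨FreeAlgebra.lift ℝ f, by
    intro x y h
    induction h with
    | anticomm j k h => simpa using h1 j k h
    | sq j => simpa using h2 j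
    | sq_last => simpa using h3
    | central j => simpa using h4 j⟩

theorem lift_e {d : ℕ} {A : Type} [Ring A] [Algebra ℝ A] (f : Fin (d + 2) → A) (h1 h2 h3 h4)
    (j : Fin (d + 2)) : lift f h1 h2 h3 h4 (e d j) = f j :=
  (RingQuot.liftAlgHom_mkAlgHom_apply ℝ _ _ _).trans (by simp)

/-- The automorphism `α`: `α(e_j) = -e_j` for `j ≤ d + 1`, and `α(e_{d+2}) = e_{d+2}`. -/
noncomputable def alpha (d : ℕ) : X d →ₐ[ℝ] X d :=
  lift (fun j => if j = Fin.last (d + 1) then e d j else -e d j)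
    (fun j k h => by simp [Fin.castSucc_ne_last, e_anticomm j k h])
    (fun j => by simp [Fin.castSucc_ne_last, e_sq])
    (by simp [e_last_sq])
    (fun j => by simp [Fin.castSucc_ne_last, e_last_comm])

/-- The anti-automorphism `t` with `t(e_j) = e_j` for all `j`, as an algebra map to the opposite
algebra. -/
noncomputable def transpose (d : ℕ) : X d →ₐ[ℝ] (X d)ᵐᵒᵖ :=
  lift (fun j => MulOpposite.op (e d j))
    (fun j k h => by
      rw [← MulOpposite.op_mul, ← MulOpposite.op_mul, e_anticomm j k h]; simp)
    (fun j => by rw [← MulOpposite.op_mul, e_sq]; simp)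
    (by rw [← MulOpposite.op_mul, e_last_sq]; simp)
    (fun j => by rw [← MulOpposite.op_mul, ← MulOpposite.op_mul, e_last_comm]; simp)

/-- Conjugation `x ↦ α(t(x))`. -/
noncomputable def conj {d : ℕ} (x : X d) : X d := alpha d (MulOpposite.unop (transpose d x))

/-- The norm `N(x) = x * conj x`. -/
noncomputable def N {d : ℕ} (x : X d) : X d := x * conj x

/-! ### The standard basis of `X_d` -/

/-- The product of the `e_j` with `j ∈ S`, in increasing order. -/
noncomputable def mono (d : ℕ) (S : Finset (Fin (d + 2))) : X d :=
  ((S.sort (· ≤ ·)).map (e d)).prod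

theorem mono_empty (d : ℕ) : mono d ∅ = 1 := by simp [mono]

theorem mono_insert {d : ℕ} {k : Fin (d + 2)} {S : Finset (Fin (d + 2))} (h : ∀ j ∈ S, k < j) :
    mono d (insert k S) = e d k * mono d S := by
  have hk : k ∉ S := fun hk => lt_irrefl _ (h k hk)
  rw [mono, Finset.sort_insert _ (fun j hj => (h j hj).le) hk]
  simp [mono]

theorem e_mul_mono {d : ℕ} (S : Finset (Fin (d + 2))) :
    ∀ j, ∃ (c : ℝ) (T : Finset (Fin (d + 2))),
      e d j * mono d S = c • mono d T ∧ ∀ k ∈ T, k = j ∨ k ∈ S := by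
  induction S using Finset.induction_on_min with
  | empty =>
    intro j
    refine ⟨1, {j}, ?_, by simp⟩
    rw [← insert_empty_eq, mono_insert (by simp), one_smul]
  | insert m S hm ih =>
    intro j
    rcases lt_trichotomy j m with hj | rfl | hj
    · refine ⟨1, insert j (insert m S), ?_, by simp⟩
      rw [mono_insert (k := j), one_smul]
      intro k hk
      rcases Finset.mem_insert.mp hk with rfl | hk
      · exact hj
      · exact hj.trans (hm k hk)
    · rw [mono_insert hm, ← mul_assoc]
      induction j using Fin.lastCases with
      | last => exact ⟨0, S, by rw [e_last_sq]; simp, fun k hk => by simp [hk]⟩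
      | cast j => exact ⟨-1, S, by rw [e_sq]; simp, fun k hk => by simp [hk]⟩
    · obtain ⟨c, T, h, hT⟩ := ih j
      have hmT : ∀ k ∈ T, m < k := by
        intro k hk
        rcases hT k hk with rfl | hk
        · exact hj
        · exact hm k hk
      have hsw : ∃ c' : ℝ, e d j * e d m = c' • (e d m * e d j) := by
        induction m using Fin.lastCases with
        | last => exact absurd hj (not_lt.mpr (Fin.le_last j))
        | cast m =>
          induction j using Fin.lastCases with
          | last => exact ⟨1, by rw [e_last_comm, one_smul]⟩
          | cast j =>
            refine ⟨-1, ?_⟩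
            rw [e_anticomm j m (fun h => by subst h; exact lt_irrefl _ hj)]
            simp
      obtain ⟨c', hc'⟩ := hsw
      refine ⟨c' * c, insert m T, ?_, ?_⟩
      · rw [mono_insert hm, ← mul_assoc, hc', mono_insert hmT, smul_mul_assoc, mul_assoc, h,
          mul_smul_comm, smul_smul]
      · intro k hk
        rcases Finset.mem_insert.mp hk with rfl | hk
        · simp
        · rcases hT k hk with rfl | hk
          · simp
          · simp [hk]

theorem span_mono (d : ℕ) : ⊤ ≤ Submodule.span ℝ (Set.range (mono d)) := by
  set W := Submodule.span ℝ (Set.range (mono d)) with hW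
  have hmul : ∀ j, ∀ w ∈ W, e d j * w ∈ W := by
    intro j w hw
    induction hw using Submodule.span_induction with
    | mem x hx =>
      obtain ⟨S, rfl⟩ := hx
      obtain ⟨c, T, h, -⟩ := e_mul_mono S j
      rw [h]
      exact W.smul_mem _ (Submodule.subset_span ⟨T, rfl⟩)
    | zero => simp
    | add x y _ _ hx hy => rw [mul_add]; exact W.add_mem hx hy
    | smul c x _ hx => rw [mul_smul_comm]; exact W.smul_mem _ hx
  have key : ∀ y : FreeAlgebra ℝ (Fin (d + 2)), ∀ w ∈ W,
      mk d y * w ∈ W := by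
    intro y
    induction y using FreeAlgebra.induction with
    | grade0 r =>
      intro w hw
      rw [AlgHom.commutes, ← Algebra.smul_def]
      exact W.smul_mem _ hw
    | grade1 j => exact hmul j
    | mul a b ha hb =>
      intro w hw
      rw [map_mul, mul_assoc]
      exact ha _ (hb _ hw)
    | add a b ha hb =>
      intro w hw
      rw [map_add, add_mul]
      exact W.add_mem (ha _ hw) (hb _ hw)
  intro x _
  obtain ⟨y, rfl⟩ := RingQuot.mkAlgHom_surjective ℝ (Rel d) x
  have := key y 1 (Submodule.subset_span ⟨∅, mono_empty d⟩)
  rwa [mul_one] at this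

/-- The sign in `e_j * mono S = ± mono (S ∆ {j})` for `j ≤ d + 1`. -/
noncomputable def sgn {d : ℕ} (j : Fin (d + 2)) (S : Finset (Fin (d + 2))) : ℝ :=
  ∏ k ∈ S, (if k ≤ j then -1 else 1)

theorem sgn_symmDiff {d : ℕ} (j k : Fin (d + 2)) (S : Finset (Fin (d + 2))) :
    sgn j (symmDiff S {k}) = (if k ≤ j then -1 else 1) * sgn j S := by
  by_cases hk : k ∈ S
  · have h1 : symmDiff S {k} = S.erase k := by
      ext x; simp only [Finset.mem_symmDiff, Finset.mem_singleton, Finset.mem_erase]; grind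
    rw [h1, sgn, sgn, ← Finset.mul_prod_erase S _ hk, ← mul_assoc]
    split_ifs <;> simp
  · have h1 : symmDiff S {k} = insert k S := by
      ext x; simp only [Finset.mem_symmDiff, Finset.mem_singleton, Finset.mem_insert]; grind
    rw [h1, sgn, sgn, Finset.prod_insert hk]

theorem sgn_mul_self {d : ℕ} (j : Fin (d + 2)) (S : Finset (Fin (d + 2))) :
    sgn j S * sgn j S = 1 := by
  rw [sgn, ← Finset.prod_mul_distrib]
  exact Finset.prod_eq_one fun k _ => by split_ifs <;> simp

/-- Left multiplication by a generator in coordinates; it serves to prove that the monomials are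
linearly independent. -/
noncomputable def act (d : ℕ) (j : Fin (d + 2)) :
    Module.End ℝ (Finset (Fin (d + 2)) →₀ ℝ) :=
  Finsupp.linearCombination ℝ fun S =>
    if j = Fin.last (d + 1) then
      (if j ∈ S then 0 else Finsupp.single (symmDiff S {j}) (1 : ℝ))
    else Finsupp.single (symmDiff S {j}) (sgn j S)

theorem act_castSucc {d : ℕ} (j : Fin (d + 1)) (S : Finset (Fin (d + 2))) (r : ℝ) :
    act d j.castSucc (Finsupp.single S r)
      = Finsupp.single (symmDiff S {j.castSucc}) (r * sgn j.castSucc S) := by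
  simp [act, Fin.castSucc_ne_last]

theorem act_last {d : ℕ} (S : Finset (Fin (d + 2))) (r : ℝ) :
    act d (Fin.last (d + 1)) (Finsupp.single S r) = if Fin.last (d + 1) ∈ S then 0 else
      Finsupp.single (symmDiff S {Fin.last (d + 1)}) r := by
  simp only [act, Finsupp.linearCombination_single, if_true]
  split_ifs <;> simp

/-- The left regular representation in coordinates. -/
noncomputable def rep (d : ℕ) : X d →ₐ[ℝ] Module.End ℝ (Finset (Fin (d + 2)) →₀ ℝ) :=
  lift (act d)
    (fun j k h => by
      refine Finsupp.lhom_ext fun S r => ?_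
      simp only [LinearMap.add_apply, Module.End.mul_apply, act_castSucc, sgn_symmDiff,
        LinearMap.zero_apply, Fin.castSucc_le_castSucc_iff]
      rw [symmDiff_right_comm S, ← Finsupp.single_add]
      rw [Finsupp.single_eq_zero]
      rcases lt_or_gt_of_ne h with h | h
      · rw [if_pos h.le, if_neg h.not_ge]; ring
      · rw [if_pos h.le, if_neg h.not_ge]; ring)
    (fun j => by
      refine Finsupp.lhom_ext fun S r => ?_
      simp only [LinearMap.add_apply, Module.End.mul_apply, act_castSucc, sgn_symmDiff,
        LinearMap.zero_apply, Module.End.one_apply, symmDiff_symmDiff_cancel_right]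
      rw [← Finsupp.single_add, Finsupp.single_eq_zero, if_pos le_rfl]
      linear_combination -r * sgn_mul_self j.castSucc S)
    (by
      refine Finsupp.lhom_ext fun S r => ?_
      simp only [Module.End.mul_apply, act_last, LinearMap.zero_apply]
      split_ifs with h
      · simp
      · rw [act_last, if_pos (by simp [Finset.mem_symmDiff, h])])
    (fun j => by
      refine Finsupp.lhom_ext fun S r => ?_
      have hj : Fin.last (d + 1) ≠ j.castSucc := (Fin.castSucc_ne_last j).symm
      simp only [LinearMap.sub_apply, Module.End.mul_apply, act_last, act_castSucc,
        LinearMap.zero_apply, Finset.mem_symmDiff, Finset.mem_singleton, hj]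
      by_cases h : Fin.last (d + 1) ∈ S
      · simp [h]
      · simp only [h, false_and, or_false, if_false, not_false_iff]
        rw [act_castSucc, sgn_symmDiff, if_neg (not_le.mpr (Fin.castSucc_lt_last j)),
          symmDiff_right_comm, one_mul, sub_self])

theorem rep_mono {d : ℕ} (S : Finset (Fin (d + 2))) :
    rep d (mono d S) (Finsupp.single ∅ 1) = Finsupp.single S 1 := by
  induction S using Finset.induction_on_min with
  | empty => simp [mono_empty]
  | insert m S hm ih =>
    have hmS : m ∉ S := fun h => lt_irrefl _ (hm m h)
    have h1 : symmDiff S {m} = insert m S := by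
      ext x; simp only [Finset.mem_symmDiff, Finset.mem_singleton, Finset.mem_insert]; grind
    rw [mono_insert hm, map_mul, Module.End.mul_apply, ih, rep, lift_e]
    induction m using Fin.lastCases with
    | last => rw [act_last, if_neg hmS, h1]
    | cast m =>
      have h2 : sgn m.castSucc S = 1 :=
        Finset.prod_eq_one fun k hk => if_neg (not_le.mpr (hm k hk))
      rw [act_castSucc, h1, h2, one_mul]

theorem linearIndependent_mono (d : ℕ) : LinearIndependent ℝ (mono d) := by
  let L : X d →ₗ[ℝ] (Finset (Fin (d + 2)) →₀ ℝ) :=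
    (LinearMap.applyₗ (Finsupp.single ∅ (1 : ℝ))).comp (rep d).toLinearMap
  refine LinearIndependent.of_comp L ?_
  have : L ∘ mono d = fun S => Finsupp.single S (1 : ℝ) := funext fun S => rep_mono S
  rw [this]
  exact Finsupp.linearIndependent_single_one ℝ _

/-- The standard basis of `X_d`: products, in increasing order, of distinct generators. -/
noncomputable def stdBasis (d : ℕ) : Module.Basis (Finset (Fin (d + 2))) ℝ (X d) :=
  Module.Basis.mk (linearIndependent_mono d) (span_mono d)

/-! ### The subspaces `Z_d^0` and `Cl_d^0` -/

/-- The elements `e_1, …, e_d, e_{d+1} e_{d+2}`, the last product counting as one element. -/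
noncomputable def g (d : ℕ) (j : Fin (d + 1)) : X d :=
  if j = Fin.last d then e d j.castSucc * e d (Fin.last (d + 1)) else e d j.castSucc

/-- The product, in increasing order, of the elements of `e_1, …, e_d, e_{d+1} e_{d+2}` with index
in `S`. If `S` has `m` elements, `m` even, this is an `m`-term of `Z_d^0`. -/
noncomputable def zmono (d : ℕ) (S : Finset (Fin (d + 1))) : X d :=
  ((S.sort (· ≤ ·)).map (g d)).prod

/-- The subspace `Z_d^0`, spanned by the products of an even number of elements from
`e_1, …, e_d, e_{d+1} e_{d+2}`. -/
noncomputable def Z0 (d : ℕ) : Submodule ℝ (X d) :=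
  Submodule.span ℝ (zmono d '' {S | Even S.card})

/-- The set of generators occurring in `zmono d S`. -/
def support {d : ℕ} (S : Finset (Fin (d + 1))) : Finset (Fin (d + 2)) :=
  S.map Fin.castSuccEmb ∪ if Fin.last d ∈ S then {Fin.last (d + 1)} else ∅

/-- The spanning elements of `Z_d^0` belong to the standard basis of `X_d`. -/
theorem stdBasis_support {d : ℕ} (S : Finset (Fin (d + 1))) :
    stdBasis d (support S) = zmono d S := by
  rw [stdBasis, Module.Basis.mk_apply]
  induction S using Finset.induction_on_min with
  | empty => simp [support, zmono, mono_empty]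
  | insert m S hm ih =>
    have hmS : m ∉ S := fun h => lt_irrefl _ (hm m h)
    have hz : zmono d (insert m S) = g d m * zmono d S := by
      rw [zmono, Finset.sort_insert _ (fun j hj => (hm j hj).le) hmS]
      simp [zmono]
    rw [hz]
    by_cases hml : m = Fin.last d
    · subst hml
      have hS : S = ∅ := Finset.eq_empty_of_forall_notMem fun j hj =>
        absurd (hm j hj) (not_lt.mpr (Fin.le_last j))
      subst hS
      have h1 : support (insert (Fin.last d) ∅)
          = insert (Fin.last d).castSucc (insert (Fin.last (d + 1)) ∅) := by
        ext x; simp [support]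
      rw [h1, mono_insert (by simp [Fin.castSucc_lt_last]), mono_insert (by simp), mono_empty]
      simp [g, zmono]
    · have h1 : support (insert m S) = insert m.castSucc (support S) := by
        simp [support, Ne.symm hml]
      rw [h1, mono_insert, ih, g, if_neg hml]
      intro j hj
      simp only [support, Finset.mem_union, Finset.mem_map] at hj
      rcases hj with ⟨k, hk, rfl⟩ | hj
      · exact Fin.castSucc_lt_castSucc_iff.mpr (hm k hk)
      · split_ifs at hj
        · rw [Finset.mem_singleton.mp hj]; exact Fin.castSucc_lt_last m
        · simp at hj

/-- The coefficient of `zmono d S` in the expansion in the standard basis. For `S` of even size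
these are the coordinates that identify `Z_d^0` with `ℝ^(2^d)`. -/
noncomputable def coeff {d : ℕ} (S : Finset (Fin (d + 1))) : X d →ₗ[ℝ] ℝ :=
  (stdBasis d).coord (support S)

/-- The subalgebra `Cl_d` of `X_d`: the span of the products of distinct elements from
`e_1, …, e_d`. -/
noncomputable def Cl (d : ℕ) : Submodule ℝ (X d) :=
  Submodule.span ℝ (mono d '' {S | ∀ j ∈ S, (j : ℕ) < d})

/-- The even part `Cl_d^0 = {x ∈ Cl_d : α(x) = x}`. -/
noncomputable def Cl0 (d : ℕ) : Submodule ℝ (X d) :=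
  Cl d ⊓ LinearMap.eqLocus (alpha d).toLinearMap LinearMap.id

/-! ### `Spun(d)`, `T_ap` and `F_ap` -/

/-- The linear map `i : ℝ^d → X_d` taking the standard basis to `e_1, …, e_d`. -/
noncomputable def vec {d : ℕ} (v : EuclideanSpace ℝ (Fin d)) : X d :=
  ∑ j : Fin d, v j • e d j.castSucc.castSucc

/-- The element `e_{d+1}`. -/
noncomputable def e₁ (d : ℕ) : X d := e d (Fin.last d).castSucc

/-- The element `e_{d+2}`. -/
noncomputable def e₂ (d : ℕ) : X d := e d (Fin.last (d + 1))

/-- The copy `e_{d+2} i(v) + e_{d+1}` of the point `v` in `X_d`. -/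
noncomputable def point {d : ℕ} (v : EuclideanSpace ℝ (Fin d)) : X d := e₂ d * vec v + e₁ d

/-- The group `Spun(d)`, as a subset of `X_d`. -/
def SpunSet (d : ℕ) : Set (X d) :=
  {z | z ∈ Z0 d ∧ N z = 1 ∧ ∀ v : EuclideanSpace ℝ (Fin d), ∃ w : EuclideanSpace ℝ (Fin d),
    z * point v * conj z = point w}

/-- The map `τ`, which takes `point v` back to `v`. -/
noncomputable def tau {d : ℕ} : X d → EuclideanSpace ℝ (Fin d) := Function.invFun point

/-- The action `w^x` of `x ∈ Spun(d)` on `w ∈ ℝ^d`. -/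
noncomputable def action {d : ℕ} (x : X d) (w : EuclideanSpace ℝ (Fin d)) :
    EuclideanSpace ℝ (Fin d) := tau (x * point w * conj x)

/-- `T_ap`: the elements of `Spun(d)` whose action takes `a` to `p`. -/
def T {d : ℕ} (a p : EuclideanSpace ℝ (Fin d)) : Set (X d) :=
  {x | x ∈ SpunSet d ∧ action x a = p}

/-- `F_ap = (1 + ½ e_{d+1} e_{d+2} i(p)) Cl_d^0 (1 - ½ e_{d+1} e_{d+2} i(a))`. -/
def F {d : ℕ} (a p : EuclideanSpace ℝ (Fin d)) : Set (X d) :=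
  (fun x => (1 + (1 / 2 : ℝ) • (e₁ d * e₂ d * vec p)) * x
    * (1 - (1 / 2 : ℝ) • (e₁ d * e₂ d * vec a))) '' (Cl0 d : Set (X d))

/-! ### The projection `η_d` -/

/-- The hyperplane `H_0`: the coefficient of `1` vanishes. (It is only used inside `Z_d^0`, which
contains `T_ap`, `Spun(d)` and `F_ap`.) -/
def H0 (d : ℕ) : Set (X d) := {x | coeff ∅ x = 0}

/-- `Spun(d)_+`: the elements of `Spun(d)` with positive coefficient of `1`. -/
def SpunPos (d : ℕ) : Set (X d) := {x | x ∈ SpunSet d ∧ 0 < coeff ∅ x}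

/-- The index set of the basis elements of `Z_d^0` that are 2-terms. -/
abbrev TwoTerm (d : ℕ) : Type := {S : Finset (Fin (d + 1)) // S.card = 2}

/-- The linear projection that keeps the coordinates of the 2-terms. -/
noncomputable def etaLin (d : ℕ) : X d →ₗ[ℝ] (TwoTerm d → ℝ) :=
  LinearMap.pi fun S => coeff S.1

/-- The map `η_d`, used off `H_0`: scale `x` so that the coefficient of `1` becomes `1`, then keep
the coordinates of the 2-terms. -/
noncomputable def eta (d : ℕ) (x : X d) : TwoTerm d → ℝ := etaLin d ((coeff ∅ x)⁻¹ • x)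

end Spun

namespace Spun

variable {d : ℕ}

/-! ### Induction, conjugation and coordinates in `X_d` -/

/-! Since `e_{d+2}` is central with square zero, `X_d` consists of dual numbers over the Clifford
algebra on `e_1, …, e_{d+1}`. An element of `Z_d^0` is `s + e_{d+1} e_{d+2} u` with `s` even and `u`
odd in `Cl_d`. Norm one means `s s̄ = 1` and `s ū + u s̄ = 0`; such an element of `Spun(d)` then
acts by `v ↦ s v s̄ + 2 u s̄`. If it takes `a` to `p`, then `u = ½ (p s - s a)`, which is exactly
the form of an element of `F_ap` (`F_eq`, `exists_of_mem_T`). Hence `T_ap ⊆ F_ap`, with `s` as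
parameter on both sides (`param`). Conversely, every `s` in the spin group gives an element of
`T_ap` (`param_mem_T`).

The scalar part of `param a p s` is that of `s`, and its 2-terms depend only on the scalar part and
the 2-terms of `s` (`paramTwo_eq_zero`). So `η_d` of `F_ap` off `H_0` is the image under a linear
map of the affine space of even `s` with scalar part `1` (`eta_image_F`). To reach all of it from
`T_ap` it suffices that spin elements with positive scalar part realize every ratio of 2-terms to
scalar part (`exists_lipschitz`, `exists_spin`), a Cayley-type statement that rests on the
invertibility of identity plus skew-symmetric. The flat projects bijectively onto the 2-terms in
`e_1, …, e_d`, which gives the dimension (`finrank_paramTwo`). -/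

theorem X_induction {P : X d → Prop} (hc : ∀ r : ℝ, P (algebraMap ℝ (X d) r))
    (he : ∀ j, P (e d j)) (hm : ∀ x y, P x → P y → P (x * y))
    (ha : ∀ x y, P x → P y → P (x + y)) (x : X d) : P x := by
  obtain ⟨y, rfl⟩ := RingQuot.mkAlgHom_surjective ℝ (Rel d) x
  change P (mk d y)
  induction y using FreeAlgebra.induction with
  | grade0 r => rw [AlgHom.commutes]; exact hc r
  | grade1 j => exact he j
  | mul a b h1 h2 => rw [map_mul]; exact hm _ _ h1 h2
  | add a b h1 h2 => rw [map_add]; exact ha _ _ h1 h2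

theorem alpha_castSucc (j : Fin (d + 1)) : alpha d (e d j.castSucc) = -e d j.castSucc := by
  rw [alpha, lift_e, if_neg (Fin.castSucc_ne_last j)]

theorem alpha_last : alpha d (e d (Fin.last (d + 1))) = e d (Fin.last (d + 1)) := by
  rw [alpha, lift_e, if_pos rfl]

theorem conj_mul (x y : X d) : conj (x * y) = conj y * conj x := by simp [conj]

theorem conj_add (x y : X d) : conj (x + y) = conj x + conj y := by simp [conj]

theorem conj_smul (r : ℝ) (x : X d) : conj (r • x) = r • conj x := by simp [conj]

theorem conj_algebraMap (r : ℝ) : conj (algebraMap ℝ (X d) r) = algebraMap ℝ (X d) r := by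
  simp [conj, MulOpposite.algebraMap_apply]

theorem conj_one : conj (1 : X d) = 1 := by simp [conj]

theorem conj_neg (x : X d) : conj (-x) = -conj x := by simp [conj]

theorem conj_sub (x y : X d) : conj (x - y) = conj x - conj y := by simp [conj]

theorem conj_castSucc (j : Fin (d + 1)) : conj (e d j.castSucc) = -e d j.castSucc := by
  rw [conj, transpose, lift_e, MulOpposite.unop_op, alpha_castSucc]

theorem conj_last : conj (e d (Fin.last (d + 1))) = e d (Fin.last (d + 1)) := by
  rw [conj, transpose, lift_e, MulOpposite.unop_op, alpha_last]

theorem alpha_conj (x : X d) : alpha d (conj x) = conj (alpha d x) := by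
  induction x using X_induction with
  | hc r => simp [conj_algebraMap]
  | he j =>
    induction j using Fin.lastCases with
    | last => simp [conj_last, alpha_last]
    | cast j => simp [conj_castSucc, alpha_castSucc, conj_neg]
  | hm x y hx hy => rw [conj_mul, map_mul, map_mul, conj_mul, hx, hy]
  | ha x y hx hy => rw [conj_add, map_add, map_add, conj_add, hx, hy]

theorem e_last_mul (x : X d) : e d (Fin.last (d + 1)) * x = x * e d (Fin.last (d + 1)) := by
  induction x using X_induction with
  | hc r => exact (Algebra.commutes r _).symm
  | he j =>
    induction j using Fin.lastCases with
    | last => rfl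
    | cast j => exact e_last_comm j
  | hm x y hx hy => rw [← mul_assoc, hx, mul_assoc, hy, mul_assoc]
  | ha x y hx hy => rw [mul_add, hx, hy, add_mul]

theorem stdBasis_apply (S : Finset (Fin (d + 2))) : stdBasis d S = mono d S := by
  rw [stdBasis, Module.Basis.mk_apply]

/-- The regular representation applied to the coordinate vector of `1` gives the coordinates of `x`.
Coordinates of a product `e_j x` can thus be read off from `act`. -/
theorem repr_eq_rep (x : X d) : (stdBasis d).repr x = rep d x (Finsupp.single ∅ 1) := by
  let L : X d →ₗ[ℝ] (Finset (Fin (d + 2)) →₀ ℝ) :=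
    (LinearMap.applyₗ (Finsupp.single ∅ (1 : ℝ))).comp (rep d).toLinearMap
  have : (stdBasis d).repr.toLinearMap = L := by
    refine (stdBasis d).ext fun S => ?_
    change (stdBasis d).repr (stdBasis d S) = L (stdBasis d S)
    rw [Module.Basis.repr_self, stdBasis_apply]
    exact (rep_mono S).symm
  exact LinearMap.congr_fun this x

theorem repr_mono (S : Finset (Fin (d + 2))) :
    (stdBasis d).repr (mono d S) = Finsupp.single S 1 := by
  rw [← stdBasis_apply, Module.Basis.repr_self]

theorem symmDiff_eq_comm {α : Type*} [DecidableEq α] {S T U : Finset α} :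
    symmDiff T U = S ↔ T = symmDiff S U := by
  constructor
  · rintro rfl; rw [symmDiff_symmDiff_cancel_right]
  · rintro rfl; rw [symmDiff_symmDiff_cancel_right]

theorem repr_e_mul (j : Fin (d + 1)) (x : X d) (S : Finset (Fin (d + 2))) :
    (stdBasis d).repr (e d j.castSucc * x) S
      = sgn j.castSucc (symmDiff S {j.castSucc})
        * (stdBasis d).repr x (symmDiff S {j.castSucc}) := by
  have hact : ∀ F : Finset (Fin (d + 2)) →₀ ℝ, act d j.castSucc F S
      = sgn j.castSucc (symmDiff S {j.castSucc}) * F (symmDiff S {j.castSucc}) := by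
    intro F
    induction F using Finsupp.induction_linear with
    | zero => simp
    | add F G hF hG => rw [map_add, Finsupp.add_apply, hF, hG, Finsupp.add_apply, mul_add]
    | single T r =>
      rw [act_castSucc, Finsupp.single_apply, Finsupp.single_apply]
      by_cases h : T = symmDiff S {j.castSucc}
      · rw [if_pos (symmDiff_eq_comm.mpr h), if_pos h, h, mul_comm]
      · rw [if_neg (fun h' => h (symmDiff_eq_comm.mp h')), if_neg h, mul_zero]
  rw [repr_eq_rep, repr_eq_rep, map_mul, Module.End.mul_apply, rep, lift_e, hact]

theorem repr_last_mul (x : X d) (S : Finset (Fin (d + 2))) :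
    (stdBasis d).repr (e d (Fin.last (d + 1)) * x) S
      = if Fin.last (d + 1) ∈ S then (stdBasis d).repr x (S.erase (Fin.last (d + 1))) else 0 := by
  have hact : ∀ F : Finset (Fin (d + 2)) →₀ ℝ, act d (Fin.last (d + 1)) F S
      = if Fin.last (d + 1) ∈ S then F (S.erase (Fin.last (d + 1))) else 0 := by
    intro F
    induction F using Finsupp.induction_linear with
    | zero => simp
    | add F G hF hG =>
      rw [map_add, Finsupp.add_apply, hF, hG, Finsupp.add_apply]
      split_ifs <;> simp
    | single T r =>
      rw [act_last]
      by_cases hT : Fin.last (d + 1) ∈ T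
      · have : T ≠ S.erase (Fin.last (d + 1)) := by rintro rfl; simp at hT
        simp [hT, this]
      · have h1 : symmDiff T {Fin.last (d + 1)} = insert (Fin.last (d + 1)) T := by
          ext x; simp only [Finset.mem_symmDiff, Finset.mem_singleton, Finset.mem_insert]; grind
        rw [if_neg hT, h1, Finsupp.single_apply, Finsupp.single_apply]
        by_cases hS : Fin.last (d + 1) ∈ S
        · rw [if_pos hS]
          congr 1
          rw [eq_iff_iff]
          constructor
          · rintro rfl; rw [Finset.erase_insert hT]
          · rintro rfl; rw [Finset.insert_erase hS]
        · rw [if_neg hS, if_neg]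
          rintro rfl
          simp at hS
  rw [repr_eq_rep, repr_eq_rep, map_mul, Module.End.mul_apply, rep, lift_e, hact]

/-! ### The scalar part -/

/-- The coefficient of `1`. -/
noncomputable def scal (d : ℕ) : X d →ₗ[ℝ] ℝ := (stdBasis d).coord ∅

theorem scal_apply (x : X d) : scal d x = (stdBasis d).repr x ∅ := rfl

theorem scal_one : scal d 1 = 1 := by
  rw [scal_apply, ← mono_empty, repr_mono]; simp

theorem coeff_empty (x : X d) : coeff ∅ x = scal d x := by
  have : support (∅ : Finset (Fin (d + 1))) = ∅ := by simp [support]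
  rw [coeff, this]; rfl

theorem scal_e_mul (j : Fin (d + 1)) (x : X d) :
    scal d (e d j.castSucc * x) = -(stdBasis d).repr x {j.castSucc} := by
  rw [scal_apply, repr_e_mul, ← Finset.bot_eq_empty, bot_symmDiff]
  simp [sgn]

/-- Because `e_j e_i e_i e_j = 1`, multiplying by `e_j e_i` moves the 2-term coefficient into the
scalar part. From here on, 2-terms are handled through `scal`. -/
theorem scal_e_mul_e_mul {i j : Fin (d + 1)} (h : i < j) (x : X d) :
    scal d (e d j.castSucc * (e d i.castSucc * x))
      = (stdBasis d).repr x {i.castSucc, j.castSucc} := by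
  have h1 : symmDiff {j.castSucc} {i.castSucc} = ({i.castSucc, j.castSucc} : Finset _) := by
    have := h.ne
    ext x
    simp only [Finset.mem_symmDiff, Finset.mem_singleton, Finset.mem_insert]
    have : i.castSucc ≠ j.castSucc := fun h => this (Fin.castSucc_injective _ h)
    grind
  have h2 : i.castSucc ≠ j.castSucc := fun h' => h.ne (Fin.castSucc_injective _ h')
  rw [scal_e_mul, repr_e_mul, h1, sgn, Finset.prod_pair h2, if_pos le_rfl,
    if_neg (not_le.mpr (Fin.castSucc_lt_castSucc_iff.mpr h))]
  ring

theorem mono_mul_e (S : Finset (Fin (d + 2))) (j : Fin (d + 2)) :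
    ∃ c : ℝ, mono d S * e d j = c • (e d j * mono d S) := by
  induction S using Finset.induction_on_min with
  | empty => exact ⟨1, by simp [mono_empty]⟩
  | insert m S hm ih =>
    obtain ⟨c, hc⟩ := ih
    have hsw : ∃ c' : ℝ, e d m * e d j = c' • (e d j * e d m) := by
      by_cases hmj : m = j
      · exact ⟨1, by rw [hmj, one_smul]⟩
      induction m using Fin.lastCases with
      | last => exact ⟨1, by rw [e_last_mul, one_smul]⟩
      | cast m =>
        induction j using Fin.lastCases with
        | last => exact ⟨1, by rw [e_last_mul, one_smul]⟩
        | cast j =>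
          exact ⟨-1, by rw [e_anticomm m j (fun h => hmj (by rw [h]))]; simp⟩
    obtain ⟨c', hc'⟩ := hsw
    refine ⟨c * c', ?_⟩
    rw [mono_insert hm, mul_assoc, hc, mul_smul_comm, ← mul_assoc, hc', smul_mul_assoc, smul_smul,
      mul_assoc]

theorem mono_singleton (j : Fin (d + 2)) : mono d {j} = e d j := by
  rw [← insert_empty_eq, mono_insert (by simp), mono_empty, mul_one]

/-- The scalar part is a trace. For a generator against a monomial, the two products agree up to a
scalar factor and have no scalar part unless the monomial is that generator, in which case they
coincide. -/
theorem scal_mul_comm (x y : X d) : scal d (x * y) = scal d (y * x) := by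
  revert y
  induction x using X_induction with
  | hc r => intro y; rw [Algebra.commutes]
  | hm x x' hx hx' => intro y; rw [mul_assoc, hx, mul_assoc, hx', mul_assoc]
  | ha x x' hx hx' => intro y; rw [add_mul, mul_add, map_add, map_add, hx, hx']
  | he j =>
    intro y
    suffices h : (scal d).comp (LinearMap.mulLeft ℝ (e d j))
        = (scal d).comp (LinearMap.mulRight ℝ (e d j)) from LinearMap.congr_fun h y
    refine (stdBasis d).ext fun S => ?_
    simp only [LinearMap.comp_apply, LinearMap.mulLeft_apply, LinearMap.mulRight_apply,
      stdBasis_apply]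
    by_cases hS : S = {j}
    · rw [hS, mono_singleton]
    have h0 : scal d (e d j * mono d S) = 0 := by
      induction j using Fin.lastCases with
      | last => rw [scal_apply, repr_last_mul, if_neg (by simp)]
      | cast j => rw [scal_e_mul, repr_mono, Finsupp.single_eq_of_ne (Ne.symm hS), neg_zero]
    obtain ⟨c, hc⟩ := mono_mul_e S j
    rw [hc, map_smul, h0, smul_zero]


/-! ### The Clifford subalgebras -/

/-- The subalgebra generated by `e_1, …, e_k`. -/
noncomputable def clGen (d k : ℕ) : Subalgebra ℝ (X d) :=
  Algebra.adjoin ℝ (e d '' {j | (j : ℕ) < k})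

theorem e_mem_clGen {k : ℕ} {j : Fin (d + 2)} (h : (j : ℕ) < k) : e d j ∈ clGen d k :=
  Algebra.subset_adjoin ⟨j, h, rfl⟩

theorem clGen_mono {k l : ℕ} (h : k ≤ l) : clGen d k ≤ clGen d l :=
  Algebra.adjoin_mono (Set.image_mono fun _ hj => lt_of_lt_of_le hj h)

theorem mono_mem_clGen {k : ℕ} {S : Finset (Fin (d + 2))} (h : ∀ j ∈ S, (j : ℕ) < k) :
    mono d S ∈ clGen d k := by
  refine Subalgebra.list_prod_mem _ fun x hx => ?_
  obtain ⟨j, hj, rfl⟩ := List.mem_map.mp hx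
  exact e_mem_clGen (h j ((Finset.mem_sort _).mp hj))

/-- The span of the monomials contains `1` and is stable under left multiplication by the generators
(`e_mul_mono`), so it contains the generated subalgebra. -/
theorem clGen_toSubmodule (k : ℕ) : Subalgebra.toSubmodule (clGen d k)
    = Submodule.span ℝ (mono d '' {S | ∀ j ∈ S, (j : ℕ) < k}) := by
  set W := Submodule.span ℝ (mono d '' {S | ∀ j ∈ S, (j : ℕ) < k}) with hW
  refine le_antisymm ?_ ?_
  · have key : ∀ x ∈ clGen d k, ∀ w ∈ W, x * w ∈ W := by
      intro x hx
      induction hx using Algebra.adjoin_induction with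
      | mem x hx =>
        obtain ⟨j, hj, rfl⟩ := hx
        intro w hw
        induction hw using Submodule.span_induction with
        | mem x hx =>
          obtain ⟨S, hS, rfl⟩ := hx
          obtain ⟨c, T, h, hT⟩ := e_mul_mono S j
          rw [h]
          refine W.smul_mem _ (Submodule.subset_span ⟨T, fun i hi => ?_, rfl⟩)
          rcases hT i hi with rfl | hi
          · exact hj
          · exact hS i hi
        | zero => simp
        | add x y _ _ hx hy => rw [mul_add]; exact W.add_mem hx hy
        | smul c x _ hx => rw [mul_smul_comm]; exact W.smul_mem _ hx
      | algebraMap r => intro w hw; rw [← Algebra.smul_def]; exact W.smul_mem _ hw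
      | add x y _ _ hx hy => intro w hw; rw [add_mul]; exact W.add_mem (hx w hw) (hy w hw)
      | mul x y _ _ hx hy => intro w hw; rw [mul_assoc]; exact hx _ (hy w hw)
    intro x hx
    have := key x hx 1 (Submodule.subset_span ⟨∅, by simp, mono_empty d⟩)
    rwa [mul_one] at this
  · rw [hW, Submodule.span_le]
    rintro _ ⟨S, hS, rfl⟩
    exact mono_mem_clGen hS

theorem mem_Cl {x : X d} : x ∈ Cl d ↔ x ∈ clGen d d := by
  rw [Cl, ← clGen_toSubmodule, Subalgebra.mem_toSubmodule]

theorem mem_Cl0 {x : X d} : x ∈ Cl0 d ↔ x ∈ clGen d d ∧ alpha d x = x := by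
  rw [Cl0, Submodule.mem_inf, mem_Cl, LinearMap.mem_eqLocus]; rfl

theorem repr_eq_zero_of_mem_clGen {k : ℕ} {x : X d} (hx : x ∈ clGen d k)
    {S : Finset (Fin (d + 2))} {j : Fin (d + 2)} (hj : j ∈ S) (hk : k ≤ j) :
    (stdBasis d).repr x S = 0 := by
  rw [← Subalgebra.mem_toSubmodule, clGen_toSubmodule] at hx
  induction hx using Submodule.span_induction with
  | mem x hx =>
    obtain ⟨T, hT, rfl⟩ := hx
    rw [repr_mono, Finsupp.single_eq_of_ne]
    rintro rfl
    exact absurd (hT j hj) (not_lt.mpr hk)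
  | zero => simp
  | add x y _ _ hx hy => rw [map_add, Finsupp.add_apply, hx, hy, add_zero]
  | smul c x _ hx => rw [map_smul, Finsupp.smul_apply, hx, smul_zero]

theorem scal_e_mul_eq_zero {k : ℕ} {x : X d} (hx : x ∈ clGen d k) {j : Fin (d + 1)}
    (hk : k ≤ j) : scal d (e d j.castSucc * x) = 0 := by
  rw [scal_e_mul, repr_eq_zero_of_mem_clGen hx (Finset.mem_singleton_self _) (by simpa using hk),
    neg_zero]

theorem conj_mem_clGen {k : ℕ} {x : X d} (hx : x ∈ clGen d k) : conj x ∈ clGen d k := by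
  induction hx using Algebra.adjoin_induction with
  | mem x hx =>
    obtain ⟨j, hj, rfl⟩ := hx
    have := e_mem_clGen hj
    induction j using Fin.lastCases with
    | last => rwa [conj_last]
    | cast j => rw [conj_castSucc]; exact neg_mem this
  | algebraMap r => rw [conj_algebraMap]; exact Subalgebra.algebraMap_mem _ r
  | add x y _ _ hx hy => rw [conj_add]; exact add_mem hx hy
  | mul x y _ _ hx hy => rw [conj_mul]; exact mul_mem hy hx

theorem alpha_mem_clGen {k : ℕ} {x : X d} (hx : x ∈ clGen d k) : alpha d x ∈ clGen d k := by
  induction hx using Algebra.adjoin_induction with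
  | mem x hx =>
    obtain ⟨j, hj, rfl⟩ := hx
    have := e_mem_clGen hj
    induction j using Fin.lastCases with
    | last => rwa [alpha_last]
    | cast j => rw [alpha_castSucc]; exact neg_mem this
  | algebraMap r => rw [AlgHom.commutes]; exact Subalgebra.algebraMap_mem _ r
  | add x y _ _ hx hy => rw [map_add]; exact add_mem hx hy
  | mul x y _ _ hx hy => rw [map_mul]; exact mul_mem hx hy

/-! ### Parity in `Cl_d`. -/

theorem e₁_mul {x : X d} (hx : x ∈ clGen d d) : e₁ d * x = alpha d x * e₁ d := by
  induction hx using Algebra.adjoin_induction with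
  | mem x hx =>
    obtain ⟨j, hj, rfl⟩ := hx
    induction j using Fin.lastCases with
    | last => simp at hj
    | cast j =>
      rw [alpha_castSucc, e₁, e_anticomm, neg_mul]
      rintro rfl
      simp at hj
  | algebraMap r => rw [AlgHom.commutes, Algebra.commutes]
  | add x y _ _ hx hy => rw [map_add, mul_add, add_mul, hx, hy]
  | mul x y _ _ hx hy => rw [map_mul, ← mul_assoc, hx, mul_assoc, hy, mul_assoc]

theorem alpha_mono {S : Finset (Fin (d + 2))} (h : ∀ j ∈ S, (j : ℕ) < d) :
    alpha d (mono d S) = (-1 : ℝ) ^ S.card • mono d S := by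
  induction S using Finset.induction_on_min with
  | empty => simp [mono_empty]
  | insert m S hm ih =>
    have hmS : m ∉ S := fun h => lt_irrefl _ (hm m h)
    have h1 : alpha d (e d m) = -e d m := by
      have := h m (Finset.mem_insert_self _ _)
      induction m using Fin.lastCases with
      | last => simp at this
      | cast m => exact alpha_castSucc m
    rw [mono_insert hm, map_mul, ih fun j hj => h j (Finset.mem_insert_of_mem hj), h1,
      Finset.card_insert_of_notMem hmS, pow_succ]
    simp

theorem alpha_alpha {x : X d} (hx : x ∈ clGen d d) : alpha d (alpha d x) = x := by
  rw [← Subalgebra.mem_toSubmodule, clGen_toSubmodule] at hx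
  induction hx using Submodule.span_induction with
  | mem x hx =>
    obtain ⟨T, hT, rfl⟩ := hx
    rw [alpha_mono hT, map_smul, alpha_mono hT, smul_smul, ← mul_pow]
    simp
  | zero => simp
  | add x y _ _ hx hy => rw [map_add, map_add, hx, hy]
  | smul c x _ hx => rw [map_smul, map_smul, hx]

/-- An element of `Cl_d` on which `α` acts as a sign is a combination of monomials of that
parity. -/
theorem mem_span_of_alpha_eq_smul {x : X d} (hx : x ∈ clGen d d) {c : ℝ} (hc : c * c = 1)
    (h : alpha d x = c • x) :
    x ∈ Submodule.span ℝ (mono d '' {S | (∀ j ∈ S, (j : ℕ) < d) ∧ (-1 : ℝ) ^ S.card = c}) := by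
  set W := Submodule.span ℝ
    (mono d '' {S | (∀ j ∈ S, (j : ℕ) < d) ∧ (-1 : ℝ) ^ S.card = c}) with hW
  -- The operator `y ↦ y + c α(y)` doubles the monomials of sign `c` and kills the others, while it
  -- doubles the given `x`.
  have key : ∀ y ∈ Submodule.span ℝ (mono d '' {S | ∀ j ∈ S, (j : ℕ) < d}),
      y + c • alpha d y ∈ W := by
    intro y hy
    induction hy using Submodule.span_induction with
    | mem y hy =>
      obtain ⟨S, hS, rfl⟩ := hy
      rw [alpha_mono hS]
      by_cases hSc : (-1 : ℝ) ^ S.card = c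
      · have hmem : mono d S ∈ W := Submodule.subset_span ⟨S, ⟨hS, hSc⟩, rfl⟩
        exact W.add_mem hmem (W.smul_mem _ (W.smul_mem _ hmem))
      · have h2 : c * (-1 : ℝ) ^ S.card = -1 := by
          rcases neg_one_pow_eq_or ℝ S.card with h' | h' <;>
          rcases mul_self_eq_one_iff.mp hc with rfl | rfl <;> rw [h'] at hSc ⊢ <;>
          first | exact absurd rfl hSc | norm_num
        rw [smul_smul, h2]
        simp
    | zero => simp
    | add x y _ _ hx hy =>
      have := W.add_mem hx hy
      rwa [add_add_add_comm, ← smul_add, ← map_add] at this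
    | smul r x _ hx =>
      have := W.smul_mem r hx
      rwa [smul_add, smul_comm r c, ← map_smul] at this
  have h1 := key x (by rwa [← clGen_toSubmodule, Subalgebra.mem_toSubmodule])
  rw [h, smul_smul, hc, one_smul, ← two_smul ℝ x] at h1
  have h2 := W.smul_mem (2⁻¹ : ℝ) h1
  rwa [smul_smul, inv_mul_cancel₀ two_ne_zero, one_smul] at h2

/-! ### The decomposition of `Z_d^0` -/

theorem mono_insert_max {k : Fin (d + 2)} {S : Finset (Fin (d + 2))} (h : ∀ j ∈ S, j < k) :
    mono d (insert k S) = mono d S * e d k := by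
  induction S using Finset.induction_on_min with
  | empty => rw [insert_empty_eq, mono_singleton, mono_empty, one_mul]
  | insert m S hm ih =>
    rw [Finset.insert_comm, mono_insert, mono_insert hm, mul_assoc,
      ih fun j hj => h j (Finset.mem_insert_of_mem hj)]
    intro j hj
    rcases Finset.mem_insert.mp hj with rfl | hj
    · exact h m (Finset.mem_insert_self _ _)
    · exact hm j hj

theorem zmono_eq_mono {S : Finset (Fin (d + 1))} (h : Fin.last d ∉ S) :
    zmono d S = mono d (S.map Fin.castSuccEmb) := by
  rw [← stdBasis_support, stdBasis_apply, support, if_neg h, Finset.union_empty]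

theorem zmono_insert_last {S : Finset (Fin (d + 1))} (h : Fin.last d ∉ S) :
    zmono d (insert (Fin.last d) S) = mono d (S.map Fin.castSuccEmb) * e₁ d * e₂ d := by
  have h1 : support (insert (Fin.last d) S) = insert (Fin.last (d + 1))
      (insert (Fin.last d).castSucc (S.map Fin.castSuccEmb)) := by
    ext x; simp [support]
    tauto
  rw [← stdBasis_support, stdBasis_apply, h1, mono_insert_max, mono_insert_max, e₁, e₂]
  · intro j hj
    obtain ⟨i, hi, rfl⟩ := Finset.mem_map.mp hj
    refine Fin.castSucc_lt_castSucc_iff.mpr (Fin.lt_last_iff_ne_last.mpr ?_)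
    rintro rfl
    exact h hi
  · intro j hj
    rcases Finset.mem_insert.mp hj with rfl | hj
    · exact Fin.castSucc_lt_last _
    · obtain ⟨i, hi, rfl⟩ := Finset.mem_map.mp hj
      exact Fin.castSucc_lt_last _

theorem lt_of_mem_map {S : Finset (Fin (d + 1))} (h : Fin.last d ∉ S) :
    ∀ j ∈ S.map Fin.castSuccEmb, (j : ℕ) < d := by
  intro j hj
  obtain ⟨i, hi, rfl⟩ := Finset.mem_map.mp hj
  have : i < Fin.last d := Fin.lt_last_iff_ne_last.mpr (by rintro rfl; exact h hi)
  exact this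

theorem exists_map_castSuccEmb {S : Finset (Fin (d + 2))} (h : ∀ j ∈ S, (j : ℕ) < d) :
    ∃ S₀ : Finset (Fin (d + 1)), Fin.last d ∉ S₀ ∧ S₀.map Fin.castSuccEmb = S := by
  refine ⟨Finset.univ.filter fun j => j.castSucc ∈ S, fun hl => ?_, ?_⟩
  · have := h _ (Finset.mem_filter.mp hl).2
    simp at this
  · ext j
    simp only [Finset.mem_map, Finset.mem_filter, Finset.mem_univ, true_and]
    constructor
    · rintro ⟨i, hi, rfl⟩; exact hi
    · intro hj
      induction j using Fin.lastCases with
      | last => have := h _ hj; simp at this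
      | cast j => exact ⟨j, hj, rfl⟩

/-- A basis product either avoids `e_{d+1} e_{d+2}` and is an even monomial of `Cl_d`, or ends with
it after an odd monomial. Moving `e_{d+1}` to the front applies `α`, which explains the `α` in the
witness for `u`. -/
theorem exists_of_mem_Z0 {x : X d} (hx : x ∈ Z0 d) : ∃ s u : X d, s ∈ clGen d d ∧
    alpha d s = s ∧ u ∈ clGen d d ∧ alpha d u = -u ∧ x = s + e₁ d * e₂ d * u := by
  induction hx using Submodule.span_induction with
  | mem x hx =>
    obtain ⟨S, hS, rfl⟩ := hx
    by_cases hl : Fin.last d ∈ S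
    · have hn := Finset.notMem_erase (Fin.last d) S
      have hcard := Finset.card_erase_add_one hl
      refine ⟨0, alpha d (mono d ((S.erase (Fin.last d)).map Fin.castSuccEmb)), zero_mem _,
        map_zero _, alpha_mem_clGen (mono_mem_clGen (lt_of_mem_map hn)), ?_, ?_⟩
      · have hodd : Odd (S.erase (Fin.last d)).card := by
          have : Even S.card := hS
          rw [← hcard, Nat.even_add_one] at this
          exact Nat.not_even_iff_odd.mp this
        rw [alpha_mono (lt_of_mem_map hn), Finset.card_map, hodd.neg_one_pow, map_smul,
          alpha_mono (lt_of_mem_map hn), Finset.card_map, hodd.neg_one_pow]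
        simp
      · have hm := mono_mem_clGen (lt_of_mem_map hn)
        rw [zero_add, mul_assoc, e₂, e_last_mul, ← e₂, ← mul_assoc, e₁_mul (alpha_mem_clGen hm),
          alpha_alpha hm, ← zmono_insert_last hn, Finset.insert_erase hl]
    · refine ⟨zmono d S, 0, ?_, ?_, zero_mem _, by simp, by simp⟩
      · rw [zmono_eq_mono hl]; exact mono_mem_clGen (lt_of_mem_map hl)
      · have : Even S.card := hS
        rw [zmono_eq_mono hl, alpha_mono (lt_of_mem_map hl), Finset.card_map, this.neg_one_pow,
          one_smul]
  | zero => exact ⟨0, 0, zero_mem _, map_zero _, zero_mem _, by simp, by simp⟩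
  | add x y _ _ hx hy =>
    obtain ⟨s, u, h1, h2, h3, h4, rfl⟩ := hx
    obtain ⟨s', u', h1', h2', h3', h4', rfl⟩ := hy
    refine ⟨s + s', u + u', add_mem h1 h1', by rw [map_add, h2, h2'], add_mem h3 h3',
      by rw [map_add, h4, h4', neg_add], by rw [mul_add]; abel⟩
  | smul c x _ hx =>
    obtain ⟨s, u, h1, h2, h3, h4, rfl⟩ := hx
    refine ⟨c • s, c • u, Subalgebra.smul_mem _ h1 c, by rw [map_smul, h2],
      Subalgebra.smul_mem _ h3 c, by rw [map_smul, h4, smul_neg], by rw [smul_add, mul_smul_comm]⟩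

theorem even_mem_Z0 {s : X d} (hs : s ∈ clGen d d) (h : alpha d s = s) : s ∈ Z0 d := by
  have := mem_span_of_alpha_eq_smul hs (one_mul 1) (by rw [h, one_smul])
  refine Submodule.span_le.mpr ?_ this
  rintro _ ⟨S, ⟨hS, hc⟩, rfl⟩
  obtain ⟨S₀, h0, rfl⟩ := exists_map_castSuccEmb hS
  rw [← zmono_eq_mono h0]
  refine Submodule.subset_span ⟨S₀, ?_, rfl⟩
  by_contra h'
  rw [Finset.card_map, (Nat.not_even_iff_odd.mp h').neg_one_pow] at hc
  norm_num at hc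

theorem odd_mem_Z0 {u : X d} (hu : u ∈ clGen d d) (h : alpha d u = -u) :
    e₁ d * e₂ d * u ∈ Z0 d := by
  have := mem_span_of_alpha_eq_smul hu (c := -1) (by norm_num) (by rw [h, neg_one_smul])
  suffices hle : Submodule.span ℝ
      (mono d '' {S | (∀ j ∈ S, (j : ℕ) < d) ∧ (-1 : ℝ) ^ S.card = -1})
      ≤ (Z0 d).comap (LinearMap.mulLeft ℝ (e₁ d * e₂ d)) from hle this
  rw [Submodule.span_le]
  rintro _ ⟨S, ⟨hS, hc⟩, rfl⟩
  obtain ⟨S₀, h0, rfl⟩ := exists_map_castSuccEmb hS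
  have hodd : Odd S₀.card := by
    by_contra h'
    rw [Finset.card_map, (Nat.not_odd_iff_even.mp h').neg_one_pow] at hc
    norm_num at hc
  change e₁ d * e₂ d * mono d (S₀.map Fin.castSuccEmb) ∈ Z0 d
  rw [mul_assoc, e₂, e_last_mul, ← e₂, ← mul_assoc, e₁_mul (mono_mem_clGen hS), alpha_mono hS,
    Finset.card_map, hodd.neg_one_pow, smul_mul_assoc, smul_mul_assoc, ← zmono_insert_last h0]
  refine Submodule.smul_mem _ _ (Submodule.subset_span ⟨_, ?_, rfl⟩)
  change Even _
  rw [Finset.card_insert_of_notMem h0, Nat.even_add_one]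
  exact Nat.not_even_iff_odd.mpr hodd


/-! ### Vectors -/

theorem vec_add (v w : EuclideanSpace ℝ (Fin d)) : vec (v + w) = vec v + vec w := by
  simp [vec, add_smul, Finset.sum_add_distrib]

theorem vec_smul (r : ℝ) (v : EuclideanSpace ℝ (Fin d)) : vec (r • v) = r • vec v := by
  simp [vec, mul_smul, Finset.smul_sum]

theorem vec_sub (v w : EuclideanSpace ℝ (Fin d)) : vec (v - w) = vec v - vec w := by
  simp [vec, sub_smul, Finset.sum_sub_distrib]

theorem vec_single (i : Fin d) :
    vec (EuclideanSpace.single i (1 : ℝ)) = e d i.castSucc.castSucc := by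
  simp [vec]

theorem vec_mem_clGen (v : EuclideanSpace ℝ (Fin d)) : vec v ∈ clGen d d :=
  Subalgebra.sum_mem _ fun j _ => Subalgebra.smul_mem _ (e_mem_clGen (by simp)) _

theorem alpha_vec (v : EuclideanSpace ℝ (Fin d)) : alpha d (vec v) = -vec v := by
  simp [vec, alpha_castSucc]

theorem conj_vec (v : EuclideanSpace ℝ (Fin d)) : conj (vec v) = -vec v := by
  have : transpose d (vec v) = MulOpposite.op (vec v) := by
    simp [vec, transpose, lift_e]
  rw [conj, this, MulOpposite.unop_op, alpha_vec]

theorem scal_e_mul_e (i j : Fin d) :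
    scal d (e d i.castSucc.castSucc * e d j.castSucc.castSucc) = if i = j then -1 else 0 := by
  rw [scal_e_mul, ← mono_singleton, repr_mono, Finsupp.single_apply]
  by_cases h : i = j
  · simp [h]
  · simp [h, Ne.symm h]

theorem scal_e_mul_vec (i : Fin d) (v : EuclideanSpace ℝ (Fin d)) :
    scal d (e d i.castSucc.castSucc * vec v) = -v i := by
  rw [vec, Finset.mul_sum, map_sum]
  simp [scal_e_mul_e]

theorem vec_injective : Function.Injective (vec (d := d)) := by
  intro v w h
  ext i
  have := scal_e_mul_vec i v
  rw [h, scal_e_mul_vec] at this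
  exact (neg_injective this).symm

theorem e_mul_e_add (i j : Fin d) :
    e d i.castSucc.castSucc * e d j.castSucc.castSucc
      + e d j.castSucc.castSucc * e d i.castSucc.castSucc
      = algebraMap ℝ (X d) (if i = j then -2 else 0) := by
  by_cases h : i = j
  · rw [h, if_pos rfl, e_sq, map_neg, map_ofNat]; norm_num
  · rw [e_anticomm _ _ fun h' => h (Fin.castSucc_injective _ h'), if_neg h, map_zero]; simp

theorem vec_mul_vec_add (v w : EuclideanSpace ℝ (Fin d)) :
    vec v * vec w + vec w * vec v = algebraMap ℝ (X d) (-2 * ∑ i, v i * w i) := by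
  have h1 : vec v * vec w + vec w * vec v
      = ∑ i, ∑ j, (v i * w j) • (e d i.castSucc.castSucc * e d j.castSucc.castSucc
      + e d j.castSucc.castSucc * e d i.castSucc.castSucc) := by
    simp only [vec, smul_add, Finset.sum_add_distrib, Finset.sum_mul_sum]
    congr 1
    · simp only [smul_mul_smul_comm]
    · rw [Finset.sum_comm]; simp only [smul_mul_smul_comm, mul_comm]
  rw [h1]
  simp only [e_mul_e_add, Algebra.algebraMap_eq_smul_one, smul_smul, ← Finset.sum_smul]
  congr 1
  simp [Finset.mul_sum, mul_comm]

theorem vec_mul_self (v : EuclideanSpace ℝ (Fin d)) :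
    vec v * vec v = algebraMap ℝ (X d) (-∑ i, v i * v i) := by
  have h := vec_mul_vec_add v v
  rw [← two_smul ℝ (vec v * vec v)] at h
  have h2 := congrArg (fun x => (2⁻¹ : ℝ) • x) h
  simp only [smul_smul] at h2
  rw [inv_mul_cancel₀ two_ne_zero, one_smul] at h2
  rw [h2, Algebra.smul_def, ← map_mul]
  congr 1
  ring

/-- A reflection preserves the space of vectors. -/
theorem exists_vec_mul_vec_mul_vec (x v : EuclideanSpace ℝ (Fin d)) :
    ∃ w : EuclideanSpace ℝ (Fin d), vec x * vec v * vec x = vec w := by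
  refine ⟨(-2 * ∑ i, x i * v i) • x - (-∑ i, x i * x i) • v, ?_⟩
  rw [vec_sub, vec_smul, vec_smul, eq_sub_of_add_eq (vec_mul_vec_add x v), sub_mul, mul_assoc,
    vec_mul_self, Algebra.smul_def, Algebra.smul_def, Algebra.commutes _ (vec v)]

/-! ### Dual number calculus with `e_{d+2}` -/

theorem e₁_mul_self : e₁ d * e₁ d = -1 := e_sq _

theorem e₁_mem_clGen : e₁ d ∈ clGen d (d + 1) := e_mem_clGen (by simp)

theorem dual_mul (a b a' b' : X d) :
    (a + e₂ d * b) * (a' + e₂ d * b') = a * a' + e₂ d * (a * b' + b * a') := by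
  have h0 : e₂ d * b * (e₂ d * b') = 0 := by
    rw [mul_assoc, ← mul_assoc b, e₂, ← e_last_mul b, mul_assoc, ← mul_assoc, e_last_sq, zero_mul]
  have h1 : a * (e₂ d * b') = e₂ d * (a * b') := by
    rw [← mul_assoc, e₂, ← e_last_mul a, mul_assoc]
  rw [add_mul, mul_add, mul_add, h0, h1, mul_add, add_zero, mul_assoc]
  abel

/-- The standard monomials of `a` avoid `e_{d+2}` and those of `e_{d+2} b` all contain it, so
nothing cancels between the two parts. -/
theorem dual_eq_zero {a b : X d} (ha : a ∈ clGen d (d + 1)) (hb : b ∈ clGen d (d + 1))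
    (h : a + e₂ d * b = 0) : a = 0 ∧ b = 0 := by
  have h' : ∀ S, (stdBasis d).repr a S + (stdBasis d).repr (e₂ d * b) S = 0 := by
    intro S
    rw [← Finsupp.add_apply, ← map_add, h, map_zero, Finsupp.zero_apply]
  have hlast : d + 1 ≤ (Fin.last (d + 1) : ℕ) := le_rfl
  constructor <;> refine (stdBasis d).repr.map_eq_zero_iff.mp (Finsupp.ext fun S => ?_)
  · rw [Finsupp.zero_apply]
    by_cases hS : Fin.last (d + 1) ∈ S
    · exact repr_eq_zero_of_mem_clGen ha hS hlast
    · have := h' S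
      rwa [e₂, repr_last_mul, if_neg hS, add_zero] at this
  · rw [Finsupp.zero_apply]
    by_cases hS : Fin.last (d + 1) ∈ S
    · exact repr_eq_zero_of_mem_clGen hb hS hlast
    · have := h' (insert (Fin.last (d + 1)) S)
      rwa [e₂, repr_last_mul, if_pos (Finset.mem_insert_self _ _), Finset.erase_insert hS,
        repr_eq_zero_of_mem_clGen ha (Finset.mem_insert_self _ _) hlast, zero_add] at this

theorem dual_inj {a b a' b' : X d} (ha : a ∈ clGen d (d + 1)) (hb : b ∈ clGen d (d + 1))
    (ha' : a' ∈ clGen d (d + 1)) (hb' : b' ∈ clGen d (d + 1))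
    (h : a + e₂ d * b = a' + e₂ d * b') : a = a' ∧ b = b' := by
  have := dual_eq_zero (sub_mem ha ha') (sub_mem hb hb') (by
    rw [mul_sub, sub_add_sub_comm, h, sub_self])
  exact ⟨sub_eq_zero.mp this.1, sub_eq_zero.mp this.2⟩

theorem e₁_mul_eq_zero {x : X d} (h : e₁ d * x = 0) : x = 0 := by
  have := congrArg (e₁ d * ·) h
  simpa [← mul_assoc, e₁_mul_self] using this

theorem point_eq (v : EuclideanSpace ℝ (Fin d)) : point v = e₁ d + e₂ d * vec v :=
  add_comm _ _

theorem point_injective : Function.Injective (point (d := d)) := by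
  intro v w h
  rw [point_eq, point_eq] at h
  have hle := clGen_mono (d := d) (Nat.le_succ d)
  exact vec_injective (dual_inj e₁_mem_clGen (hle (vec_mem_clGen v)) e₁_mem_clGen
    (hle (vec_mem_clGen w)) h).2

/-! ### The parametrization of `T_ap` and `F_ap` -/

/-- The element `s + e_{d+1} e_{d+2} u` of `Z_d^0`, as a dual number. -/
noncomputable def ofPair (s u : X d) : X d := s + e₂ d * (e₁ d * u)

theorem ofPair_eq (s u : X d) : ofPair s u = s + e₁ d * e₂ d * u := by
  rw [ofPair, ← mul_assoc, e₂, e_last_mul (e₁ d)]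

section
variable {s u : X d}

theorem e₁_comm_even (hs : s ∈ clGen d d) (hs' : alpha d s = s) : e₁ d * s = s * e₁ d := by
  rw [e₁_mul hs, hs']

theorem e₁_comm_odd (hu : u ∈ clGen d d) (hu' : alpha d u = -u) : e₁ d * u = -(u * e₁ d) := by
  rw [e₁_mul hu, hu', neg_mul]

/-- Two signs cancel: one from conjugating `e_{d+1}`, one from moving it past the odd element `conj
u`. -/
theorem conj_ofPair (hu : u ∈ clGen d d) (hu' : alpha d u = -u) :
    conj (ofPair s u) = ofPair (conj s) (conj u) := by
  have h1 : alpha d (conj u) = -conj u := by rw [alpha_conj, hu', conj_neg]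
  have h2 : conj (e₁ d) = -e₁ d := conj_castSucc _
  have h3 : conj (e₂ d) = e₂ d := conj_last
  rw [ofPair, ofPair, conj_add, conj_mul, conj_mul, h2, h3, e₁_comm_odd (conj_mem_clGen hu) h1,
    e₂, e_last_mul, mul_neg]

theorem N_ofPair (hs : s ∈ clGen d d) (hs' : alpha d s = s)
    (hu : u ∈ clGen d d) (hu' : alpha d u = -u) :
    N (ofPair s u) = s * conj s + e₂ d * (e₁ d * (s * conj u + u * conj s)) := by
  rw [N, conj_ofPair hu hu', ofPair, ofPair, dual_mul, ← mul_assoc s, ← e₁_comm_even hs hs',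
    mul_add (e₁ d), mul_assoc, mul_assoc]

/-- The signs come from `e_{d+1} u e_{d+1} = u` for odd `u` and `e_{d+1}² = -1`. The part with
`e_{d+2}` splits into the linear action `s v s̄` and the translation `u s̄ - s ū`. -/
theorem ofPair_mul_point_mul_conj (hs : s ∈ clGen d d) (hs' : alpha d s = s)
    (hu : u ∈ clGen d d) (hu' : alpha d u = -u) (v : EuclideanSpace ℝ (Fin d)) :
    ofPair s u * point v * conj (ofPair s u) = e₁ d * (s * conj s)
      + e₂ d * (s * vec v * conj s + u * conj s - s * conj u) := by
  have h1 : e₁ d * u * e₁ d = u := by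
    rw [e₁_comm_odd hu hu', neg_mul, mul_assoc, e₁_mul_self]; simp
  have h2 : s * e₁ d * (e₁ d * conj u) = -(s * conj u) := by
    rw [mul_assoc, ← mul_assoc (e₁ d), e₁_mul_self]; simp
  rw [conj_ofPair hu hu', point_eq, ofPair, ofPair, dual_mul, dual_mul, h1, h2,
    ← e₁_comm_even hs hs', mul_assoc, add_mul]
  congr 2
  abel

end

/-- The element of `F_ap` with parameter `s`. -/
noncomputable def param (a p : EuclideanSpace ℝ (Fin d)) : X d →ₗ[ℝ] X d :=
  LinearMap.id + (1 / 2 : ℝ) • (LinearMap.mulLeft ℝ (e₂ d * e₁ d)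
    ∘ₗ (LinearMap.mulLeft ℝ (vec p) - LinearMap.mulRight ℝ (vec a)))

theorem param_apply (a p : EuclideanSpace ℝ (Fin d)) (s : X d) :
    param a p s = ofPair s ((1 / 2 : ℝ) • (vec p * s - s * vec a)) := by
  simp [param, ofPair]

theorem F_eq (a p : EuclideanSpace ℝ (Fin d)) : F a p = param a p '' (Cl0 d : Set (X d)) := by
  refine Set.image_congr fun s hs => ?_
  obtain ⟨h1, h2⟩ := mem_Cl0.mp hs
  have e1 : ∀ v : EuclideanSpace ℝ (Fin d), (1 / 2 : ℝ) • (e₁ d * e₂ d * vec v)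
      = e₂ d * ((1 / 2 : ℝ) • (e₁ d * vec v)) := by
    intro v
    rw [mul_smul_comm, ← mul_assoc, e₂, e_last_mul (e₁ d)]
  -- All three factors are written as dual numbers so that `dual_mul` multiplies them.
  have e2 : s = s + e₂ d * 0 := by simp
  rw [param_apply, ofPair, e1, e1, sub_eq_add_neg, ← mul_neg]
  conv_lhs => rw [e2]
  rw [dual_mul, dual_mul]
  simp only [one_mul, mul_one, mul_zero, zero_add, mul_neg, mul_smul_comm, smul_mul_assoc, mul_sub,
    smul_sub]
  rw [← mul_assoc s, ← mul_assoc (e₁ d) s, e₁_comm_even h1 h2, mul_assoc (e₁ d)]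
  simp only [mul_add, mul_neg, mul_smul_comm]
  abel

theorem half_mem_clGen (a p : EuclideanSpace ℝ (Fin d)) {s : X d} (hs : s ∈ clGen d d) :
    (1 / 2 : ℝ) • (vec p * s - s * vec a) ∈ clGen d d :=
  Subalgebra.smul_mem _ (sub_mem (mul_mem (vec_mem_clGen p) hs) (mul_mem hs (vec_mem_clGen a))) _

theorem alpha_half (a p : EuclideanSpace ℝ (Fin d)) {s : X d} (hs : alpha d s = s) :
    alpha d ((1 / 2 : ℝ) • (vec p * s - s * vec a))
      = -((1 / 2 : ℝ) • (vec p * s - s * vec a)) := by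
  rw [map_smul, map_sub, map_mul, map_mul, hs, alpha_vec, alpha_vec, ← smul_neg]
  congr 1
  simp only [neg_mul, mul_neg]
  abel

/-- In a finite-dimensional algebra a right inverse is also a left inverse. -/
theorem conj_mul_self_of_mul_conj {s : X d} (h : s * conj s = 1) : conj s * s = 1 := by
  have : Module.Finite ℝ (X d) := Module.Finite.of_basis (stdBasis d)
  have : IsNoetherianRing (X d) := isNoetherian_of_isNoetherianRing_of_finite ℝ (X d) |> fun _ =>
    isNoetherian_of_tower ℝ inferInstance
  exact mul_eq_one_comm.mp h

/-- The `e_{d+2}`-part of `N = 1` gives `s ū = -u s̄`, so the image of `a` is `s a s̄ + 2 u s̄`.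
Setting it equal to `p` and multiplying by `s` on the right solves for `u`. -/
theorem exists_of_mem_T {a p : EuclideanSpace ℝ (Fin d)} {x : X d} (hx : x ∈ T a p) :
    ∃ s ∈ Cl0 d, param a p s = x := by
  obtain ⟨⟨hZ, hN, hP⟩, hact⟩ := hx
  obtain ⟨s, u, hs, hs', hu, hu', rfl⟩ := exists_of_mem_Z0 hZ
  rw [← ofPair_eq] at *
  refine ⟨s, mem_Cl0.mpr ⟨hs, hs'⟩, ?_⟩
  have hle := clGen_mono (d := d) (Nat.le_succ d)
  have hcs := conj_mem_clGen hs
  have hcu := conj_mem_clGen hu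
  have hs1 : s * conj s = 1 ∧ e₁ d * (s * conj u + u * conj s) = 0 := by
    refine dual_inj (hle (mul_mem hs hcs)) (mul_mem e₁_mem_clGen
      (hle (add_mem (mul_mem hs hcu) (mul_mem hu hcs)))) (one_mem _) (zero_mem _) ?_
    rw [← N_ofPair hs hs' hu hu', hN, mul_zero, add_zero]
  have hsu := e₁_mul_eq_zero hs1.2
  obtain ⟨w, hw⟩ := hP a
  have hwp : w = p := by
    rw [← hact, action, hw, tau, Function.leftInverse_invFun point_injective]
  rw [hwp, ofPair_mul_point_mul_conj hs hs' hu hu', point_eq, hs1.1, mul_one] at hw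
  have h2 := (dual_inj e₁_mem_clGen (hle (sub_mem (add_mem (mul_mem (mul_mem hs (vec_mem_clGen a))
    hcs) (mul_mem hu hcs)) (mul_mem hs hcu))) e₁_mem_clGen (hle (vec_mem_clGen p)) hw).2
  rw [eq_neg_of_add_eq_zero_left hsu, sub_neg_eq_add] at h2
  have h3 := congrArg (· * s) h2
  simp only [add_mul, mul_assoc, conj_mul_self_of_mul_conj hs1.1, mul_one] at h3
  rw [param_apply, ← h3]
  congr 1
  rw [add_assoc, add_sub_cancel_left, ← two_smul ℝ u, smul_smul]
  norm_num

/-- Here `u s̄ = ½ (p - s a s̄)` is a combination of vectors, on which conjugation is `-1`; this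
gives the norm condition `s ū = -u s̄`. The action becomes `v ↦ s v s̄ + (p - s a s̄)`, which takes
`a` to `p`. -/
theorem param_mem_T (a p : EuclideanSpace ℝ (Fin d)) {s : X d} (hs : s ∈ clGen d d)
    (hs' : alpha d s = s) (h1 : s * conj s = 1)
    (hv : ∀ v : EuclideanSpace ℝ (Fin d), ∃ w, s * vec v * conj s = vec w) :
    param a p s ∈ T a p := by
  rw [param_apply]
  set u := (1 / 2 : ℝ) • (vec p * s - s * vec a) with hu_def
  have hu : u ∈ clGen d d := half_mem_clGen a p hs
  have hu' : alpha d u = -u := alpha_half a p hs'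
  have h2 : u * conj s = (1 / 2 : ℝ) • (vec p - s * vec a * conj s) := by
    rw [hu_def, smul_mul_assoc, sub_mul, mul_assoc, h1, mul_one]
  have h3 : s * conj u = -(u * conj s) := by
    rw [h2, hu_def, conj_smul, conj_sub, conj_mul, conj_mul, conj_vec, conj_vec, mul_smul_comm,
      ← smul_neg]
    congr 1
    rw [mul_sub, mul_neg, mul_neg, ← mul_assoc, h1, neg_mul, mul_neg, ← mul_assoc]
    simp only [one_mul]
    abel
  have key : ∀ v, ofPair s u * point v * conj (ofPair s u)
      = e₁ d + e₂ d * (s * vec v * conj s + (vec p - s * vec a * conj s)) := by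
    intro v
    rw [ofPair_mul_point_mul_conj hs hs' hu hu', h1, h3, mul_one, sub_neg_eq_add, add_assoc,
      ← two_smul ℝ (u * conj s), h2, smul_smul]
    norm_num
  obtain ⟨a', ha'⟩ := hv a
  refine ⟨⟨?_, ?_, fun v => ?_⟩, ?_⟩
  · rw [ofPair_eq]
    exact Submodule.add_mem _ (even_mem_Z0 hs hs') (odd_mem_Z0 hu hu')
  · rw [N_ofPair hs hs' hu hu', h1, h3]
    simp
  · obtain ⟨w, hw⟩ := hv v
    exact ⟨w + (p - a'), by rw [key, hw, ha', point_eq, vec_add, vec_sub]⟩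
  · have : ofPair s u * point a * conj (ofPair s u) = point p := by
      rw [key, point_eq]
      simp
    rw [action, this, tau, Function.leftInverse_invFun point_injective]


/-! ### Elements of `Spun(d)_+ ∩ Cl_d` with prescribed 2-terms -/

/-- Every bivector on the first `k` coordinates is the 2-term part of an even element with scalar
part `1` that is a product of vectors. It is built by recursion on `k`: passing from `k` to `k + 1`
multiplies by `1 + w e_{k+1}`, where `w` solves a linear system whose matrix is the identity plus a
skew-symmetric matrix. -/
theorem exists_lipschitz (B : Fin d → Fin d → ℝ) (k : ℕ) (hk : k ≤ d) :
    ∃ s ∈ clGen d k, alpha d s = s ∧ (∃ c : ℝ, 0 < c ∧ s * conj s = algebraMap ℝ (X d) c) ∧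
      (∀ v : EuclideanSpace ℝ (Fin d), ∃ w, s * vec v * conj s = vec w) ∧ scal d s = 1 ∧
      ∀ i j : Fin d, i < j → (j : ℕ) < k →
        scal d (e d j.castSucc.castSucc * (e d i.castSucc.castSucc * s)) = B i j := by
  induction k with
  | zero =>
    exact ⟨1, one_mem _, map_one _, ⟨1, one_pos, by rw [conj_one, mul_one, map_one]⟩,
      fun v => ⟨v, by rw [conj_one, mul_one, one_mul]⟩, scal_one, fun i j _ h => by simp at h⟩
  | succ k ih =>
    obtain ⟨s, hs, hs', ⟨c, hc, hsc⟩, hv, hs1, hB⟩ := ih (by omega)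
    -- `m` is the index of the new generator, `E` embeds the old indices, and `L u` is the vector
    -- with coordinates `u` in the old directions.
    let m : Fin d := ⟨k, hk⟩
    let E : Fin k → Fin d := Fin.castLE (by omega)
    let L : (Fin k → ℝ) →ₗ[ℝ] X d :=
      Fintype.linearCombination ℝ fun i => e d (E i).castSucc.castSucc
    have hLu : ∀ u, L u = ∑ i, u i • e d (E i).castSucc.castSucc :=
      fun u => Fintype.linearCombination_apply _ _ _
    have hE : ∀ i j, E i = E j ↔ i = j := fun i j => Fin.castLE_inj
    have hL : ∀ u, ∃ w : EuclideanSpace ℝ (Fin d), L u = vec w := by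
      intro u
      refine ⟨∑ i, u i • EuclideanSpace.single (E i) (1 : ℝ), ?_⟩
      have hsum : ∀ t : Finset (Fin k), vec (∑ i ∈ t, u i • EuclideanSpace.single (E i) (1 : ℝ))
          = ∑ i ∈ t, u i • e d (E i).castSucc.castSucc := by
        intro t
        induction t using Finset.induction_on with
        | empty => simp [vec]
        | insert i t hi iht =>
          rw [Finset.sum_insert hi, Finset.sum_insert hi, vec_add, vec_smul, vec_single, iht]
      rw [hsum, hLu]
    have hLmem : ∀ u, L u ∈ clGen d k := by
      intro u
      rw [hLu]
      exact Subalgebra.sum_mem _ fun i _ => Subalgebra.smul_mem _ (e_mem_clGen (by simp [E])) _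
    -- `M u i` is the coefficient of the 2-term `e_i e_{k+1}` in `s (1 + L u e_{k+1})`, with `i` an
    -- old direction.
    let M : (Fin k → ℝ) →ₗ[ℝ] (Fin k → ℝ) := LinearMap.pi fun i =>
      -(scal d ∘ₗ LinearMap.mulLeft ℝ (e d (E i).castSucc.castSucc * s) ∘ₗ L)
    have hM : ∀ u i, M u i = -scal d (e d (E i).castSucc.castSucc * (s * L u)) := by
      intro u i
      simp [M]
    have hMinj : Function.Injective M := by
      rw [← LinearMap.ker_eq_bot, LinearMap.ker_eq_bot']
      intro u hu
      obtain ⟨w, hw⟩ := hL u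
      -- The quadratic form of `M` is the squared length: by the trace property it equals `-scal ((L
      -- u)² s)`, where `(L u)²` is a scalar and `s` has scalar part `1`.
      have h1 : ∑ i, u i * M u i = ∑ i, w i * w i := by
        have h2 : ∀ x, scal d (L u * x) = ∑ i, u i * scal d (e d (E i).castSucc.castSucc * x) := by
          intro x
          rw [hLu, Finset.sum_mul, map_sum]
          simp only [smul_mul_assoc, map_smul, smul_eq_mul]
        have h3 : ∑ i, u i * M u i = -scal d (L u * (s * L u)) := by
          rw [h2, ← Finset.sum_neg_distrib]
          simp only [hM, mul_neg]
        rw [h3, scal_mul_comm, mul_assoc, hw, vec_mul_self, ← Algebra.commutes,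
          ← Algebra.smul_def, map_smul, hs1]
        simp
      rw [hu] at h1
      have h2 : w = 0 := by
        ext i
        have := (Finset.sum_eq_zero_iff_of_nonneg
          fun i _ => mul_self_nonneg (w i)).mp (h1.symm.trans (by simp)) i (Finset.mem_univ i)
        simpa using this
      have h3 : L u = 0 := by rw [hw, h2]; simp [vec]
      ext i
      have h4 : scal d (e d (E i).castSucc.castSucc * L u) = -u i := by
        rw [hLu, Finset.mul_sum, map_sum]
        simp only [mul_smul_comm, map_smul, scal_e_mul_e, hE]
        simp
      rw [h3, mul_zero, map_zero] at h4
      simpa using h4.symm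
    obtain ⟨u, hu⟩ := (LinearMap.injective_iff_surjective.mp hMinj) fun i => B (E i) m
    obtain ⟨w, hw⟩ := hL u
    have hwk : vec w ∈ clGen d k := hw ▸ hLmem u
    set y := e d m.castSucc.castSucc with hy
    have hyv : y = vec (EuclideanSpace.single m (1 : ℝ)) := (vec_single m).symm
    have hscal : ∀ x ∈ clGen d k, scal d (y * x) = 0 := fun x hx =>
      scal_e_mul_eq_zero hx (by simp [m])
    have hyy : y * y = -1 := e_sq _
    have hwy : vec w * y + y * vec w = 0 := by
      have h0 : w m = 0 := by
        have := hscal _ hwk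
        rw [hy, scal_e_mul_vec] at this
        linarith
      rw [hyv, vec_mul_vec_add]
      simp [h0]
    have hconj : conj (s * (1 + vec w * y)) = (1 + y * vec w) * conj s := by
      rw [conj_mul, conj_add, conj_mul, conj_one, hyv, conj_vec, conj_vec, neg_mul_neg]
    have hk1 := clGen_mono (d := d) (Nat.le_succ k)
    have hym : y ∈ clGen d (k + 1) := e_mem_clGen (by simp [m])
    refine ⟨s * (1 + vec w * y), mul_mem (hk1 hs) (add_mem (one_mem _) (mul_mem (hk1 hwk) hym)),
      ?_, ⟨c * (1 + ∑ i, w i * w i), mul_pos hc (add_pos_of_pos_of_nonneg one_pos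
        (Finset.sum_nonneg fun i _ => mul_self_nonneg _)), ?_⟩, ?_, ?_, ?_⟩
    · rw [map_mul, map_add, map_mul, map_one, hs', hyv, alpha_vec, alpha_vec, neg_mul_neg]
    · have h1 : (1 + vec w * y) * (1 + y * vec w)
          = algebraMap ℝ (X d) (1 + ∑ i, w i * w i) := by
        have h2 : vec w * y * (y * vec w) = algebraMap ℝ (X d) (∑ i, w i * w i) := by
          rw [mul_assoc, ← mul_assoc y, hyy, neg_one_mul, mul_neg, vec_mul_self, map_neg, neg_neg]
        rw [add_mul, one_mul, mul_add, mul_one, h2, map_add, map_one, ← add_assoc, add_assoc 1,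
          add_comm (y * vec w), hwy, add_zero]
      rw [hconj, mul_assoc, ← mul_assoc (1 + vec w * y), h1, Algebra.left_comm, hsc, ← map_mul,
        mul_comm]
    · intro v
      obtain ⟨v', hv'⟩ := exists_vec_mul_vec_mul_vec (EuclideanSpace.single m (1 : ℝ)) v
      obtain ⟨v'', hv''⟩ := exists_vec_mul_vec_mul_vec (w - EuclideanSpace.single m (1 : ℝ)) v'
      obtain ⟨z, hz⟩ := hv v''
      refine ⟨z, ?_⟩
      rw [← hyv] at hv'
      rw [vec_sub, ← hyv] at hv''
      -- The new factor is a product of two vectors, so its action is a composition of two maps of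
      -- the form `v ↦ x v x`.
      have h1 : 1 + vec w * y = (vec w - y) * y := by
        rw [sub_mul, hyy, sub_neg_eq_add, add_comm]
      have h2 : 1 + y * vec w = y * (vec w - y) := by
        rw [mul_sub, hyy, sub_neg_eq_add, add_comm]
      rw [hconj, h1, h2, ← hz, ← hv'', ← hv']
      simp only [mul_assoc]
    · rw [mul_add, mul_one, map_add, hs1, ← mul_assoc, scal_mul_comm,
        hscal _ (mul_mem hs hwk), add_zero]
    · intro i j hij hj
      rw [mul_add, mul_one, mul_add, mul_add, map_add]
      have him : e d i.castSucc.castSucc ∈ clGen d k :=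
        e_mem_clGen (by have : (i : ℕ) < j := hij; simp; omega)
      rcases Nat.lt_succ_iff_lt_or_eq.mp hj with hj | hj
      · rw [hB i j hij hj]
        -- An old 2-term is unchanged: the added term contains `y` once and otherwise only earlier
        -- generators, so it has no scalar part.
        have h1 : e d j.castSucc.castSucc * (e d i.castSucc.castSucc * (s * (vec w * y)))
            = e d j.castSucc.castSucc * (e d i.castSucc.castSucc * (s * vec w)) * y := by
          simp only [mul_assoc]
        rw [h1, scal_mul_comm, hscal, add_zero]
        exact mul_mem (e_mem_clGen (by simpa using hj)) (mul_mem him (mul_mem hs hwk))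
      · obtain rfl : j = m := Fin.ext hj
        -- For a new 2-term only the added term counts; there `y² = -1` turns it into `M u i`, which
        -- was solved to be the prescribed value.
        rw [hscal _ (mul_mem him hs), zero_add, scal_mul_comm]
        have h1 : e d i.castSucc.castSucc * (s * (vec w * y)) * y
            = -(e d i.castSucc.castSucc * (s * vec w)) := by
          simp only [mul_assoc, hyy, mul_neg, mul_one]
        have hik : (i : ℕ) < k := hij
        have h2 := congrFun hu ⟨i, hik⟩
        rw [hM, hw] at h2
        rw [← hy, h1, map_neg]
        exact h2

/-- Division by the square root of the norm makes the norm `1`; the ratios of the 2-terms to the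
scalar part do not change. -/
theorem exists_spin (B : Fin d → Fin d → ℝ) :
    ∃ s ∈ clGen d d, alpha d s = s ∧ s * conj s = 1 ∧
      (∀ v : EuclideanSpace ℝ (Fin d), ∃ w, s * vec v * conj s = vec w) ∧ 0 < scal d s ∧
      ∀ i j : Fin d, i < j →
        scal d (e d j.castSucc.castSucc * (e d i.castSucc.castSucc * s)) = scal d s * B i j := by
  obtain ⟨s, hs, hs', ⟨c, hc, hsc⟩, hv, hs1, hB⟩ := exists_lipschitz B d le_rfl
  have hr : 0 < (√c)⁻¹ := inv_pos.mpr (Real.sqrt_pos.mpr hc)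
  refine ⟨(√c)⁻¹ • s, Subalgebra.smul_mem _ hs _, by rw [map_smul, hs'], ?_, fun v => ?_, ?_,
    fun i j hij => ?_⟩
  · rw [conj_smul, smul_mul_smul_comm, hsc, Algebra.smul_def, ← map_mul, ← mul_inv,
      Real.mul_self_sqrt hc.le, inv_mul_cancel₀ hc.ne', map_one]
  · obtain ⟨w, hw⟩ := hv v
    refine ⟨((√c)⁻¹ * (√c)⁻¹) • w, ?_⟩
    rw [conj_smul, smul_mul_assoc, smul_mul_smul_comm, hw, vec_smul]
  · rw [map_smul, hs1, smul_eq_mul, mul_one]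
    exact hr
  · rw [mul_smul_comm, mul_smul_comm, map_smul, map_smul, hs1, hB i j hij j.isLt, smul_eq_mul,
      smul_eq_mul, mul_one]

/-! ### The 2-terms of the elements of `F_ap` -/

theorem scal_param (a p : EuclideanSpace ℝ (Fin d)) (s : X d) :
    scal d (param a p s) = scal d s := by
  rw [param_apply, ofPair, map_add, scal_apply (e₂ d * _), e₂, repr_last_mul, if_neg (by simp),
    add_zero]

theorem coeff_param_pair (a p : EuclideanSpace ℝ (Fin d)) (s : X d) {i j : Fin d} (h : i < j) :
    coeff {i.castSucc, j.castSucc} (param a p s)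
      = scal d (e d j.castSucc.castSucc * (e d i.castSucc.castSucc * s)) := by
  have h1 : support {i.castSucc, j.castSucc}
      = {i.castSucc.castSucc, j.castSucc.castSucc} := by
    rw [support, if_neg]
    · simp
    · simp [(Fin.castSucc_ne_last _).symm]
  have h2 : Fin.last (d + 1) ∉ ({i.castSucc.castSucc, j.castSucc.castSucc} : Finset _) := by
    simp [(Fin.castSucc_ne_last _).symm]
  rw [scal_e_mul_e_mul (Fin.castSucc_lt_castSucc_iff.mpr h), coeff, h1, Module.Basis.coord_apply,
    param_apply, ofPair, map_add, Finsupp.add_apply, e₂, repr_last_mul, if_neg h2, add_zero]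

/-- This coefficient sits in the `e_{d+2}`-part, as the coefficient of `e_i e_{d+1}` in `½ e_{d+1}
(p s - s a)`. The trace property brings `a` to the left of `s`, so both terms are combinations of
scalar parts of `e_j e_k s`. -/
theorem coeff_param_last (a p : EuclideanSpace ℝ (Fin d)) {s : X d} (hs : s ∈ clGen d d)
    (i : Fin d) : coeff {i.castSucc, Fin.last d} (param a p s)
      = (1 / 2 : ℝ) * (scal d (e d i.castSucc.castSucc * (vec p * s))
        - scal d (vec a * (e d i.castSucc.castSucc * s))) := by
  have h1 : support {i.castSucc, Fin.last d}
      = insert (Fin.last (d + 1)) {i.castSucc.castSucc, (Fin.last d).castSucc} := by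
    rw [support, if_pos (by simp), Finset.union_comm]
    simp [Finset.insert_comm]
  have h2 : Fin.last (d + 1) ∉
      ({i.castSucc.castSucc, (Fin.last d).castSucc} : Finset (Fin (d + 2))) := by
    simp [(Fin.castSucc_ne_last _).symm]
  have h3 : ∀ x, e d i.castSucc.castSucc * (e₁ d * x) * e₁ d
      = e d i.castSucc.castSucc * (e₁ d * x * e₁ d) := fun x => mul_assoc _ _ _
  have h4 : e₁ d * e d i.castSucc.castSucc * e₁ d = e d i.castSucc.castSucc := by
    rw [e₁, e_anticomm _ _ (Fin.castSucc_ne_last i).symm, neg_mul, mul_assoc, e_sq]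
    simp
  rw [coeff, h1, Module.Basis.coord_apply, param_apply, ofPair, map_add, Finsupp.add_apply,
    repr_eq_zero_of_mem_clGen hs (Finset.mem_insert_self _ _) (by simp), zero_add, e₂,
    repr_last_mul, if_pos (Finset.mem_insert_self _ _), Finset.erase_insert h2,
    ← scal_e_mul_e_mul (Fin.castSucc_lt_last i), ← e₁, ← mul_assoc, ← mul_assoc, h4,
    mul_smul_comm, map_smul, mul_sub, map_sub, ← mul_assoc _ s, scal_mul_comm _ (vec a),
    smul_eq_mul]

theorem exists_pair (S : TwoTerm d) :
    (∃ i j : Fin d, i < j ∧ S.1 = {i.castSucc, j.castSucc}) ∨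
      ∃ i : Fin d, S.1 = {i.castSucc, Fin.last d} := by
  obtain ⟨x, y, hxy, hS⟩ : ∃ x y : Fin (d + 1), x < y ∧ S.1 = {x, y} := by
    obtain ⟨x, y, hxy, hS⟩ := Finset.card_eq_two.mp S.2
    rcases lt_or_gt_of_ne hxy with h | h
    · exact ⟨x, y, h, hS⟩
    · exact ⟨y, x, h, by rw [hS, Finset.pair_comm]⟩
  induction x using Fin.lastCases with
  | last => exact absurd hxy (not_lt.mpr (Fin.le_last y))
  | cast i =>
    induction y using Fin.lastCases with
    | last => exact .inr ⟨i, hS⟩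
    | cast j => exact .inl ⟨i, j, Fin.castSucc_lt_castSucc_iff.mp hxy, hS⟩

/-- The 2-terms of `param a p s` in coordinates, as a linear function of `s`. -/
noncomputable def paramTwo (a p : EuclideanSpace ℝ (Fin d)) : X d →ₗ[ℝ] (TwoTerm d → ℝ) :=
  etaLin d ∘ₗ param a p

theorem paramTwo_apply (a p : EuclideanSpace ℝ (Fin d)) (s : X d) (S : TwoTerm d) :
    paramTwo a p s S = coeff S.1 (param a p s) := rfl

theorem eta_param (a p : EuclideanSpace ℝ (Fin d)) (s : X d) :
    eta d (param a p s) = paramTwo a p ((scal d s)⁻¹ • s) := by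
  rw [eta, coeff_empty, scal_param, paramTwo, LinearMap.comp_apply, map_smul (param a p)]

/-- Multiplication by `p` or `a` could a priori bring in 4-terms of `s`, but only the scalar parts
of `e_j e_i s` enter. For `i = j` they reduce to the scalar part of `s`, for `i > j` to the ordered
case with a sign. -/
theorem paramTwo_eq_zero (a p : EuclideanSpace ℝ (Fin d)) {s : X d} (hs : s ∈ clGen d d)
    (h0 : scal d s = 0) (h : ∀ i j : Fin d, i < j →
      scal d (e d j.castSucc.castSucc * (e d i.castSucc.castSucc * s)) = 0) :
    paramTwo a p s = 0 := by
  have h' : ∀ i j : Fin d,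
      scal d (e d j.castSucc.castSucc * (e d i.castSucc.castSucc * s)) = 0 := by
    intro i j
    rcases lt_trichotomy i j with hij | rfl | hij
    · exact h i j hij
    · rw [← mul_assoc, e_sq, neg_one_mul, map_neg, h0, neg_zero]
    · rw [← mul_assoc, e_anticomm _ _ fun h' => hij.ne (Fin.castSucc_injective _ h'), neg_mul,
        map_neg, mul_assoc, h j i hij, neg_zero]
  funext S
  rw [paramTwo_apply, Pi.zero_apply]
  rcases exists_pair S with ⟨i, j, hij, hS⟩ | ⟨i, hS⟩
  · rw [hS, coeff_param_pair a p s hij, h' i j]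
  · rw [hS, coeff_param_last a p hs]
    have h1 : scal d (e d i.castSucc.castSucc * (vec p * s)) = 0 := by
      rw [vec, Finset.sum_mul, Finset.mul_sum, map_sum]
      exact Finset.sum_eq_zero fun j _ => by
        rw [smul_mul_assoc, mul_smul_comm, map_smul, h', smul_zero]
    have h2 : scal d (vec a * (e d i.castSucc.castSucc * s)) = 0 := by
      rw [vec, Finset.sum_mul, map_sum]
      exact Finset.sum_eq_zero fun j _ => by rw [smul_mul_assoc, map_smul, h', smul_zero]
    rw [h1, h2, sub_zero, mul_zero]

theorem paramTwo_congr (a p : EuclideanSpace ℝ (Fin d)) {s s' : X d} (hs : s ∈ clGen d d)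
    (hs' : s' ∈ clGen d d) (h0 : scal d s = scal d s') (h : ∀ i j : Fin d, i < j →
      scal d (e d j.castSucc.castSucc * (e d i.castSucc.castSucc * s))
        = scal d (e d j.castSucc.castSucc * (e d i.castSucc.castSucc * s'))) :
    paramTwo a p s = paramTwo a p s' := by
  rw [← sub_eq_zero, ← map_sub]
  refine paramTwo_eq_zero a p (sub_mem hs hs') (by rw [map_sub, h0, sub_self]) fun i j hij => ?_
  rw [mul_sub, mul_sub, map_sub, h i j hij, sub_self]

/-! ### The flat -/

/-- `param a p` is linear and preserves scalar parts, so the scaling in `η_d` can be done on the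
parameter `s`. -/
theorem eta_image_F (a p : EuclideanSpace ℝ (Fin d)) :
    eta d '' (F a p \ H0 d) = paramTwo a p '' {s | s ∈ Cl0 d ∧ scal d s = 1} := by
  rw [F_eq]
  ext y
  constructor
  · rintro ⟨_, ⟨⟨s, hs, rfl⟩, hH⟩, rfl⟩
    have h0 : scal d s ≠ 0 := by
      rw [← scal_param a p, ← coeff_empty]; exact hH
    refine ⟨(scal d s)⁻¹ • s, ⟨Submodule.smul_mem _ _ hs, ?_⟩, (eta_param a p s).symm⟩
    rw [map_smul, smul_eq_mul, inv_mul_cancel₀ h0]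
  · rintro ⟨s, ⟨hs, h1⟩, rfl⟩
    refine ⟨param a p s, ⟨⟨s, hs, rfl⟩, ?_⟩, ?_⟩
    · change coeff ∅ (param a p s) ≠ 0
      rw [coeff_empty, scal_param, h1]
      exact one_ne_zero
    · rw [eta_param, h1, inv_one, one_smul]

/-- For the harder inclusion, the even `s` is replaced by a spin element with the same ratios of
2-terms to scalar part, which `paramTwo` cannot distinguish from `s`. -/
theorem eta_image_T (a p : EuclideanSpace ℝ (Fin d)) :
    eta d '' (T a p ∩ SpunPos d) = eta d '' (F a p \ H0 d) := by
  refine subset_antisymm (Set.image_mono ?_) ?_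
  · rintro x ⟨hT, -, hpos⟩
    rw [F_eq]
    exact ⟨exists_of_mem_T hT, hpos.ne'⟩
  · rw [eta_image_F]
    rintro _ ⟨s, ⟨hs, h1⟩, rfl⟩
    obtain ⟨s', hs', hα, hN, hv, hpos, hB⟩ := exists_spin fun i j =>
      scal d (e d j.castSucc.castSucc * (e d i.castSucc.castSucc * s))
    have hT := param_mem_T a p hs' hα hN hv
    refine ⟨param a p s', ⟨hT, hT.1, by rwa [coeff_empty, scal_param]⟩, ?_⟩
    rw [eta_param]
    refine paramTwo_congr a p (Subalgebra.smul_mem _ hs' _) (mem_Cl0.mp hs).1 ?_ fun i j hij => ?_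
    · rw [map_smul, smul_eq_mul, inv_mul_cancel₀ hpos.ne', h1]
    · rw [mul_smul_comm, mul_smul_comm, map_smul, hB i j hij, smul_eq_mul, ← mul_assoc,
        inv_mul_cancel₀ hpos.ne', one_mul]

theorem finrank_paramTwo (a p : EuclideanSpace ℝ (Fin d)) :
    Module.finrank ℝ ((Cl0 d ⊓ LinearMap.ker (scal d)).map (paramTwo a p)) = d.choose 2 := by
  let T₂ := {S : Finset (Fin d) // S.card = 2}
  -- `R` forgets the coordinates of the 2-terms involving `e_{d+1} e_{d+2}`; on the direction space
  -- these are determined by the others.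
  let R : (TwoTerm d → ℝ) →ₗ[ℝ] (T₂ → ℝ) := LinearMap.funLeft ℝ ℝ
    fun S => ⟨S.1.map Fin.castSuccEmb, by rw [Finset.card_map, S.2]⟩
  have hR : ∀ (s : X d) (i j : Fin d) (hij : i < j),
      R (paramTwo a p s) ⟨{i, j}, Finset.card_pair hij.ne⟩
        = scal d (e d j.castSucc.castSucc * (e d i.castSucc.castSucc * s)) := by
    intro s i j hij
    rw [← coeff_param_pair a p s hij]
    simp [R, LinearMap.funLeft_apply, paramTwo_apply]
  set D := (Cl0 d ⊓ LinearMap.ker (scal d)).map (paramTwo a p)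
  have hbij : Function.Bijective (R.domRestrict D) := by
    constructor
    · rw [← LinearMap.ker_eq_bot, LinearMap.ker_eq_bot']
      rintro ⟨_, s, ⟨hs, h0⟩, rfl⟩ hy
      refine Subtype.ext (paramTwo_eq_zero a p (mem_Cl0.mp hs).1 h0 fun i j hij => ?_)
      rw [← hR s i j hij]
      exact congrFun hy _
    · intro b
      -- Subtracting `1` removes the scalar part and leaves the 2-terms alone. The value `0` for `i
      -- ≥ j` is never used.
      obtain ⟨s, hs, hα, -, -, h1, hB⟩ := exists_lipschitz (fun i j =>
        if h : i < j then b ⟨{i, j}, Finset.card_pair h.ne⟩ else 0) d le_rfl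
      refine ⟨⟨paramTwo a p (s - 1), s - 1, ⟨mem_Cl0.mpr ⟨sub_mem hs (one_mem _), ?_⟩, ?_⟩, rfl⟩,
        ?_⟩
      · rw [map_sub, map_one, hα]
      · change scal d (s - 1) = 0
        rw [map_sub, h1, scal_one, sub_self]
      · funext ⟨S, hS⟩
        obtain ⟨i, j, hij, rfl⟩ : ∃ i j : Fin d, i < j ∧ S = {i, j} := by
          obtain ⟨x, y, hxy, hS⟩ := Finset.card_eq_two.mp hS
          rcases lt_or_gt_of_ne hxy with h | h
          · exact ⟨x, y, h, hS⟩
          · exact ⟨y, x, h, by rw [hS, Finset.pair_comm]⟩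
        rw [LinearMap.domRestrict_apply, hR _ i j hij, mul_sub, mul_sub, map_sub,
          hB i j hij j.isLt, dif_pos hij, mul_one, scal_e_mul_e, if_neg hij.ne', sub_zero]
  rw [(LinearEquiv.ofBijective _ hbij).finrank_eq, Module.finrank_fintype_fun_eq_card,
    Fintype.card_finset_len, Fintype.card_fin]

end Spun

theorem lemma5p10 (d : ℕ) (a p : EuclideanSpace ℝ (Fin d)) :
    Spun.eta d '' (Spun.T a p ∩ Spun.SpunPos d) = Spun.eta d '' (Spun.F a p \ Spun.H0 d) ∧
    Module.finrank ℝ (Spun.TwoTerm d → ℝ) = (d + 1).choose 2 ∧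
    ∃ L : AffineSubspace ℝ (Spun.TwoTerm d → ℝ),
      (L : Set (Spun.TwoTerm d → ℝ)) = Spun.eta d '' (Spun.T a p ∩ Spun.SpunPos d) ∧
      (L : Set (Spun.TwoTerm d → ℝ)).Nonempty ∧
      Module.finrank ℝ L.direction = d.choose 2 := by
  have h1 : (1 : Spun.X d) ∈ Spun.Cl0 d := Spun.mem_Cl0.mpr ⟨one_mem _, map_one _⟩
  -- The flat is the image under `paramTwo` of the even elements with scalar part `1`, an affine
  -- space through `1` whose direction is the even elements with scalar part `0`.
  refine ⟨Spun.eta_image_T a p, ?_, (AffineSubspace.mk' (1 : Spun.X d)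
    (Spun.Cl0 d ⊓ LinearMap.ker (Spun.scal d))).map (Spun.paramTwo a p).toAffineMap, ?_, ?_, ?_⟩
  · rw [Module.finrank_fintype_fun_eq_card, Fintype.card_finset_len, Fintype.card_fin]
  · rw [Spun.eta_image_T, Spun.eta_image_F, AffineSubspace.coe_map]
    refine congrArg (Spun.paramTwo a p '' ·) (Set.ext fun s => ?_)
    rw [SetLike.mem_coe, AffineSubspace.mem_mk', vsub_eq_sub, Submodule.mem_inf, LinearMap.mem_ker,
      map_sub, Spun.scal_one, sub_eq_zero, Submodule.sub_mem_iff_left _ h1]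
    rfl
  · exact ⟨_, Set.mem_image_of_mem _ (AffineSubspace.self_mem_mk' _ _)⟩
  · rw [AffineSubspace.map_direction, AffineSubspace.direction_mk', LinearMap.toAffineMap_linear,
      Spun.finrank_paramTwo]
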